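/- For a positive integer $n$ let $K_n^*$ denote the complete graph $K_n$ if $n$ is odd, and $K_n$ minus a 1-factor (perfect matching) if $n$ is even. A 2-factor is a spanning 2-regular subgraph. In particular, a $k$-cycle has $k\ge 3$ vertices. Let $v$ and $m$ be integers with $3\le m<v$. A *Hamiltonian\* minisymposium factorization* $\mathrm{HMSF}(v,m)$ is a decomposition of the edge set of $K_v^*$, for which $M$ is some set of $m$ of its vertices, into 1. $\lfloor\frac{v-1}{2}\rfloor-\lfloor\frac{m-1}{2}\rfloor$ cycles $F_i$ of length $v$ (Hamiltonian cycles), and 2. $\lfloor\frac{m-1}{2}\rfloor$ 2-factors $T_i\cup U_i$, where $T_i$ is an $m$-cycle with vertex set $M$ and $U_i$ is a $(v-m)$-cycle on the remaining $v-m$ vertices, such that the cycles $T_i$ decompose the edge set of a copy of $K_m^*$ with vertex set $M$. When $v$ and $m$ are both even, so that $K_v^*=K_v-I$ and this copy of $K_m^*$ is the complete graph on $M$ minus a 1-factor $J$, it is required that $J\subseteq I$. The notion is defined only for $3\le m<v$; for other values of $v,m$ no $\mathrm{HMSF}(v,m)$ is said to exist. **Corollary.** Let $v,m$ be non-negative integers.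 An $\mathrm{HMSF}(v,m)$ exists if and only if $m\ge 3$, and $v\ge 2m-1$ in case $m$ is even, and $v\ge 2m$ in case $m$ is odd. -/

import Mathlib

namespace Minisymposium

/-- `H` is an `r`-factor of the complete graph on `V`: a spanning `r`-regular graph. -/
def IsFactor {V : Type*} (r : ℕ) (H : SimpleGraph V) : Prop :=
  ∀ x, (H.neighborSet x).ncard = r

/-- `I` is what has to be removed from the complete graph `K_n` on `V`, `n = |V|`, to obtain
`K_n^*`: nothing when `n` is odd, a 1-factor when `n` is even.  Then `K_n^*` is `Iᶜ`. -/
def IsLeave {V : Type*} (I : SimpleGraph V) : Prop :=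
  (Odd (Nat.card V) → I = ⊥) ∧ (Even (Nat.card V) → IsFactor 1 I)

/-- The graphs `f i` decompose `G`: they are pairwise edge-disjoint and have union `G`. -/
def IsDecomposition {V ι : Type*} (G : SimpleGraph V) (f : ι → SimpleGraph V) : Prop :=
  Pairwise (fun i j => Disjoint (f i) (f j)) ∧ ⨆ i, f i = G

/-- The graph `T ∪ U` on `V`, for a graph `T` on `M ⊆ V` and a graph `U` on the complement. -/
def glue {V : Type*} {M : Set V} (T : SimpleGraph M) (U : SimpleGraph (Mᶜ : Set V)) :
    SimpleGraph V :=
  T.spanningCoe ⊔ U.spanningCoe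

/-- There is a minisymposium factorization `MSF(F, (T, U))` for the prescribed 2-factors `F i`
(on `v` vertices), `T i` (on `m` vertices) and `U i` (on `v - m` vertices).

The vertex set is `Fin v`, and `M` is the vertex set of the subsystem. The graph `K_v^*` is `Iᶜ`,
and the graph `K_m^*` on `M` is `Jᶜ`. The copies of the `F i`, `T i`, `U i` that are used are
`f i`, `t i`, `u i`. When `v` and `m` are both even, the 1-factor `J` missing from the subsystem
is contained in the 1-factor `I` missing from the whole system (for `m` odd, `J` is empty). -/
def ExistsMSF {v m : ℕ} (F : Fin ((v - 1) / 2 - (m - 1) / 2) → SimpleGraph (Fin v))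
    (T : Fin ((m - 1) / 2) → SimpleGraph (Fin m))
    (U : Fin ((m - 1) / 2) → SimpleGraph (Fin (v - m))) : Prop :=
  1 ≤ m ∧ m ≤ v ∧
  (∀ i, IsFactor 2 (F i)) ∧ (∀ i, IsFactor 2 (T i)) ∧ (∀ i, IsFactor 2 (U i)) ∧
  ∃ (M : Set (Fin v)) (I : SimpleGraph (Fin v)) (J : SimpleGraph M)
    (f : Fin ((v - 1) / 2 - (m - 1) / 2) → SimpleGraph (Fin v))
    (t : Fin ((m - 1) / 2) → SimpleGraph M)
    (u : Fin ((m - 1) / 2) → SimpleGraph (Mᶜ : Set (Fin v))),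
    M.ncard = m ∧ IsLeave I ∧ IsLeave J ∧ (Even v → J.spanningCoe ≤ I) ∧
    (∀ i, Nonempty (f i ≃g F i)) ∧ (∀ i, Nonempty (t i ≃g T i)) ∧
    (∀ i, Nonempty (u i ≃g U i)) ∧
    IsDecomposition Iᶜ (Sum.elim f (fun i => glue (t i) (u i))) ∧
    IsDecomposition Jᶜ t

/-- There is a Hamiltonian* minisymposium factorization `HMSF(v, m)`. The notion is used for a
proper, non-degenerate subsystem only, `3 ≤ m < v`. The prescribed 2-factors are `v`-cycles,
`m`-cycles and `(v - m)`-cycles. -/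
def ExistsHMSF (v m : ℕ) : Prop :=
  3 ≤ m ∧ m < v ∧
  ExistsMSF (v := v) (m := m) (fun _ => SimpleGraph.cycleGraph v)
    (fun _ => SimpleGraph.cycleGraph m) (fun _ => SimpleGraph.cycleGraph (v - m))

end Minisymposium

/-! Necessity is a count at a vertex `y` outside `M`. None of the `m` edges from `y` to `M` lies in
a 2-factor `T_i ∪ U_i`, so each lies in the leave or in one of the Hamiltonian cycles, and every
such cycle has only two edges at `y` (`ExistsHMSF.le`).

Sufficiency is an embedding argument that adds the vertices one at a time. On the current vertex set
`A`, with `s` vertices still to come, a future cycle appears as a system of disjoint paths, and `s`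
new vertices can close it up only if it has at most `s` paths. `PartialDecomposition` records this
bound together with the degree count: every vertex of `A` has exactly `s` open ends, where waiting
for a leave edge counts as an open end. A new vertex `w` must take one open end from every old
vertex, at most one from each path and at most two from each colour, and enough from the colours
with many paths to bring them down to `s - 1`. Taking the fraction `1/s` of every open end meets all
these demands fractionally. The demands form a flow network, so the fractional choice rounds to an
integral one (`exists_int_circulation`, `exists_equitable_subset`,
`PartialDecomposition.exists_choice`). When one vertex remains, each colour is a single path, and
that vertex closes it into a cycle (`PartialDecomposition.close`).

The process starts at `M`, with `s = v - m`. Started from the empty set instead, it supplies the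
Hamiltonian decomposition of `K_m^*`, whose cycle edges are then excluded. Colours of the `U_i`
start empty and avoid `M`; colours of Hamiltonian cycles start as `m` single vertices, which is
admissible if `m ≤ v - m`. For `v` even the 1-factor `J` goes into the leave. For `v` odd and `m`
even its edges go to distinct Hamiltonian colours; if `v = 2m - 1` there are `m/2` edges and `m/2`
such colours, so each colour starts with `m - 1 = s` paths, exactly the capacity. -/

/-! ### Integral circulations and equitable subsets -/

/-- Integrality of circulations: a real circulation can be rounded to an integral one. -/
theorem exists_int_circulation {V E : Type*} [Fintype V] [Fintype E] [DecidableEq V]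
    (src tgt : E → V) (x : E → ℚ)
    (hx : ∀ v, (∑ e, if src e = v then x e else 0) = ∑ e, if tgt e = v then x e else 0) :
    ∃ y : E → ℤ,
      (∀ v, (∑ e, if src e = v then y e else 0) = ∑ e, if tgt e = v then y e else 0) ∧
      ∀ e, ⌊x e⌋ ≤ y e ∧ y e ≤ ⌈x e⌉ := by
  classical
  induction hN : (Finset.univ.filter fun e => (⌊x e⌋ : ℚ) ≠ x e).card using
    Nat.strong_induction_on generalizing x with
  | _ N ih =>
  set D := Finset.univ.filter fun e => (⌊x e⌋ : ℚ) ≠ x e with hD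
  have hDm : ∀ e, e ∈ D ↔ (⌊x e⌋ : ℚ) ≠ x e := fun e => by simp [hD]
  by_cases hne : D = ∅
  · have hint : ∀ e, (⌊x e⌋ : ℚ) = x e := fun e => by
      by_contra h
      have := (hDm e).2 h
      simp [hne] at this
    refine ⟨fun e => ⌊x e⌋, fun v => ?_, fun e => ⟨le_rfl, Int.floor_le_ceil _⟩⟩
    have := hx v
    have h2 : ((∑ e, if src e = v then ⌊x e⌋ else 0 : ℤ) : ℚ)
        = ((∑ e, if tgt e = v then ⌊x e⌋ else 0 : ℤ) : ℚ) := by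
      push_cast
      simpa only [hint] using this
    exact_mod_cast h2
  -- a nonzero circulation supported on the fractional edges
  obtain ⟨z, hz0, hzD, hz⟩ : ∃ z : E → ℚ, z ≠ 0 ∧ (∀ e, e ∉ D → z e = 0) ∧
      ∀ v, (∑ e, if src e = v then z e else 0) = ∑ e, if tgt e = v then z e else 0 := by
    set T := (D.image src) ∪ (D.image tgt) with hT
    have hTD : T.card ≤ D.card := by
      -- With a single fractional edge at `t`, the flow on one side of `t` would be integral and on
      -- the other side not. A loop counts on both sides.
      have hdeg : ∀ t ∈ T, 2 ≤ (D.filter (src · = t)).card + (D.filter (tgt · = t)).card := by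
        intro t ht
        by_contra hlt
        have hxt := hx t
        rw [← Finset.sum_filter, ← Finset.sum_filter] at hxt
        have hint : ∀ (g : E → V), D.filter (g · = t) = ∅ → ∃ k : ℤ,
            ∑ e ∈ Finset.univ.filter (g · = t), x e = k := by
          intro g hg
          refine ⟨∑ e ∈ Finset.univ.filter (g · = t), ⌊x e⌋, ?_⟩
          push_cast
          refine Finset.sum_congr rfl fun e he => ?_
          by_contra h
          have : e ∈ D.filter (g · = t) := by
            simp only [Finset.mem_filter, Finset.mem_univ, true_and] at he ⊢
            exact ⟨(hDm e).2 fun h' => h h'.symm, he⟩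
          simp [hg] at this
        have hone : ∀ (g : E → V), (D.filter (g · = t)).card = 1 → ∀ k : ℤ,
            ∑ e ∈ Finset.univ.filter (g · = t), x e ≠ k := by
          intro g hg k hk
          obtain ⟨e, he⟩ := Finset.card_eq_one.1 hg
          have heD : e ∈ D.filter (g · = t) := by simp [he]
          rw [Finset.mem_filter] at heD
          have hmem : e ∈ Finset.univ.filter (g · = t) := by simp [heD.2]
          rw [← Finset.add_sum_erase _ _ hmem] at hk
          have hr : ∑ e' ∈ (Finset.univ.filter (g · = t)).erase e, x e' =
              ((∑ e' ∈ (Finset.univ.filter (g · = t)).erase e, ⌊x e'⌋ : ℤ) : ℚ) := by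
            push_cast
            refine Finset.sum_congr rfl fun e' he' => ?_
            by_contra h
            have : e' ∈ D.filter (g · = t) := by
              simp only [Finset.mem_erase, Finset.mem_filter, Finset.mem_univ, true_and] at he' ⊢
              exact ⟨(hDm e').2 fun h' => h h'.symm, he'.2⟩
            rw [he, Finset.mem_singleton] at this
            exact (Finset.mem_erase.1 he').1 this
          rw [hr] at hk
          refine (hDm e).1 heD.1 ?_
          have : x e = ((k - ∑ e' ∈ (Finset.univ.filter (g · = t)).erase e, ⌊x e'⌋ : ℤ) : ℚ) := by
            push_cast at hk ⊢
            linarith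
          rw [this, Int.floor_intCast]
        have hpos : 1 ≤ (D.filter (src · = t)).card + (D.filter (tgt · = t)).card := by
          rw [hT, Finset.mem_union, Finset.mem_image, Finset.mem_image] at ht
          rcases ht with ⟨e, he, h⟩ | ⟨e, he, h⟩
          · have : 0 < (D.filter (src · = t)).card := Finset.card_pos.2 ⟨e, by simp [he, h]⟩
            omega
          · have : 0 < (D.filter (tgt · = t)).card := Finset.card_pos.2 ⟨e, by simp [he, h]⟩
            omega
        rcases Nat.eq_zero_or_pos (D.filter (src · = t)).card with h0 | h0
        · obtain ⟨k, hk⟩ := hint src (Finset.card_eq_zero.1 h0)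
          exact hone tgt (by omega) k (hxt ▸ hk)
        · obtain ⟨k, hk⟩ := hint tgt (Finset.card_eq_zero.1 (by omega))
          exact hone src (by omega) k (hxt.trans hk)
      have h1 : D.card = ∑ t ∈ T, (D.filter (src · = t)).card :=
        Finset.card_eq_sum_card_fiberwise fun e he =>
          Finset.mem_coe.2 (Finset.mem_union_left _ (Finset.mem_image_of_mem _ he))
      have h2 : D.card = ∑ t ∈ T, (D.filter (tgt · = t)).card :=
        Finset.card_eq_sum_card_fiberwise fun e he =>
          Finset.mem_coe.2 (Finset.mem_union_right _ (Finset.mem_image_of_mem _ he))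
      have h3 := Finset.sum_le_sum hdeg
      rw [Finset.sum_add_distrib, ← h1, ← h2, Finset.sum_const, smul_eq_mul] at h3
      omega
    obtain ⟨e0, he0⟩ := Finset.nonempty_iff_ne_empty.2 hne
    have ht0 : src e0 ∈ T := Finset.mem_union_left _ (Finset.mem_image_of_mem _ he0)
    -- net flow of an edge weighting supported on `D`
    let ext : (D → ℚ) →ₗ[ℚ] (E → ℚ) :=
      { toFun := fun z e => if h : e ∈ D then z ⟨e, h⟩ else 0
        map_add' := fun a b => by ext e; by_cases h : e ∈ D <;> simp [h]
        map_smul' := fun a b => by ext e; by_cases h : e ∈ D <;> simp [h] }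
    let net : (E → ℚ) →ₗ[ℚ] (V → ℚ) :=
      { toFun := fun z v => (∑ e, if src e = v then z e else 0) - ∑ e, if tgt e = v then z e else 0
        map_add' := fun a b => by
          ext v
          simp only [Pi.add_apply, ← Finset.sum_filter, Finset.sum_add_distrib]
          ring
        map_smul' := fun c b => by
          ext v
          simp only [Pi.smul_apply, smul_eq_mul, ← Finset.sum_filter, ← Finset.mul_sum,
            RingHom.id_apply]
          ring }
    let res : (V → ℚ) →ₗ[ℚ] ((T.erase (src e0) : Finset V) → ℚ) :=
      LinearMap.funLeft ℚ ℚ (fun v => (v : V))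
    -- Conservation is imposed at all vertices of `T` but one, so there are fewer equations than
    -- unknowns. The omitted equation follows, because the net flows sum to zero.
    have hlt : Module.finrank ℚ ((T.erase (src e0) : Finset V) → ℚ) < Module.finrank ℚ (D → ℚ) := by
      rw [Module.finrank_fintype_fun_eq_card, Module.finrank_fintype_fun_eq_card,
        Fintype.card_coe, Fintype.card_coe, Finset.card_erase_of_mem ht0]
      have := Finset.card_pos.2 ⟨_, ht0⟩
      omega
    obtain ⟨z, hzk, hz0⟩ := Submodule.exists_mem_ne_zero_of_ne_bot
      (LinearMap.ker_ne_bot_of_finrank_lt (f := res ∘ₗ net ∘ₗ ext) hlt)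
    have hext : ∀ e, e ∉ D → ext z e = 0 := fun e he => by simp [ext, he]
    have hoff : ∀ v, v ≠ src e0 → net (ext z) v = 0 := by
      intro v hv
      by_cases hvT : v ∈ T
      · exact congrFun (LinearMap.mem_ker.1 hzk) ⟨v, Finset.mem_erase.2 ⟨hv, hvT⟩⟩
      · have : ∀ g : E → V, D.image g ⊆ T → (∑ e, if g e = v then ext z e else 0) = 0 := by
          intro g hg
          refine Finset.sum_eq_zero fun e _ => ?_
          split_ifs with h
          · exact hext e fun he => hvT (h ▸ hg (Finset.mem_image_of_mem _ he))
          · rfl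
        change _ - _ = (0 : ℚ)
        rw [this src Finset.subset_union_left, this tgt Finset.subset_union_right, sub_zero]
    have hsum : ∑ v, net (ext z) v = 0 := by
      change ∑ v, (_ - _) = (0 : ℚ)
      rw [Finset.sum_sub_distrib, Finset.sum_comm, sub_eq_zero]
      rw [Finset.sum_comm (f := fun v e => if tgt e = v then ext z e else 0)]
      simp
    rw [Finset.sum_eq_single (src e0) (fun v _ h => hoff v h) (by simp)] at hsum
    refine ⟨ext z, fun h => hz0 ?_, hext, fun v => sub_eq_zero.1 ?_⟩
    · ext ⟨e, he⟩
      have := congrFun h e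
      simpa [ext, he] using this
    · by_cases hv : v = src e0
      · exact hv ▸ hsum
      · exact hoff v hv
  -- move along `z` until a new edge becomes integral
  let t : E → ℚ := fun e => if 0 < z e then (⌈x e⌉ - x e) / z e else (⌊x e⌋ - x e) / z e
  obtain ⟨e1, he1⟩ : ∃ e, z e ≠ 0 := by
    by_contra! h
    exact hz0 (funext h)
  obtain ⟨e0, he0, hmin⟩ := Finset.exists_min_image (Finset.univ.filter fun e => z e ≠ 0) t
    ⟨e1, by simp [he1]⟩
  simp only [Finset.mem_filter, Finset.mem_univ, true_and] at he0 hmin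
  have htn : 0 ≤ t e0 := by
    simp only [t]
    split_ifs with h
    · exact div_nonneg (sub_nonneg.2 (Int.le_ceil _)) h.le
    · exact div_nonneg_of_nonpos (sub_nonpos.2 (Int.floor_le _)) (not_lt.1 h)
  set x' : E → ℚ := fun e => x e + t e0 * z e with hx'
  have hbd : ∀ e, (⌊x e⌋ : ℚ) ≤ x' e ∧ x' e ≤ ⌈x e⌉ := by
    intro e
    have h1 := Int.floor_le (x e)
    have h2 := Int.le_ceil (x e)
    rcases lt_trichotomy (z e) 0 with h | h | h
    · have := hmin e h.ne
      have ht : t e = (⌊x e⌋ - x e) / z e := if_neg (not_lt.2 h.le)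
      rw [ht, le_div_iff_of_neg h] at this
      have h3 : t e0 * z e ≤ 0 := mul_nonpos_of_nonneg_of_nonpos htn h.le
      simp only [hx']
      constructor <;> linarith
    · simp only [hx', h]
      constructor <;> linarith
    · have := hmin e h.ne'
      have ht : t e = (⌈x e⌉ - x e) / z e := if_pos h
      rw [ht, le_div_iff₀ h] at this
      have h3 : 0 ≤ t e0 * z e := mul_nonneg htn h.le
      simp only [hx']
      constructor <;> linarith
  have he0int : (⌊x' e0⌋ : ℚ) = x' e0 := by
    simp only [hx', t]
    split_ifs with h
    · rw [div_mul_cancel₀ _ he0, add_sub_cancel, Int.floor_intCast]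
    · rw [div_mul_cancel₀ _ he0, add_sub_cancel, Int.floor_intCast]
  have hlt : (Finset.univ.filter fun e => (⌊x' e⌋ : ℚ) ≠ x' e).card < N := by
    rw [← hN]
    refine Finset.card_lt_card (Finset.ssubset_iff_subset_ne.2 ⟨fun e he => ?_, fun h => ?_⟩)
    · by_contra hcon
      have h1 := hzD e hcon
      have h2 : (⌊x e⌋ : ℚ) = x e := by
        by_contra h
        exact hcon ((hDm e).2 h)
      simp [hx', h1, h2] at he
    · have : e0 ∈ D := by
        by_contra hcon
        exact he0 (hzD e0 hcon)
      rw [← h] at this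
      simp [he0int] at this
  have hcons : ∀ v, (∑ e, if src e = v then x' e else 0) = ∑ e, if tgt e = v then x' e else 0 := by
    intro v
    have h1 := hx v
    have h2 := hz v
    rw [← Finset.sum_filter, ← Finset.sum_filter] at h1 h2 ⊢
    simp only [hx', Finset.sum_add_distrib, ← Finset.mul_sum, h1, h2]
  obtain ⟨y, hy, hyb⟩ := ih _ hlt x' hcons rfl
  refine ⟨y, hy, fun e => ⟨(Int.le_floor.2 (hbd e).1).trans (hyb e).1,
    (hyb e).2.trans (Int.ceil_le.2 (hbd e).2)⟩⟩

/-- `d` is `n / s`, rounded up or down. -/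
def IsRounding (s n d : ℕ) : Prop :=
  ∀ q : ℕ, (q * s ≤ n → q ≤ d) ∧ (n ≤ q * s → d ≤ q)

/-- A finite set contains a subset taking from every fibre of `f`, `g` and `h ∘ g` one `s`-th part
of it, up to rounding. -/
theorem exists_equitable_subset {E A C K : Type*} [Fintype E] [Fintype A] [Fintype C] [Fintype K]
    [DecidableEq E] [DecidableEq A] [DecidableEq C] [DecidableEq K]
    (f : E → A) (g : E → C) (h : C → K) (s : ℕ) (hs : 0 < s) :
    ∃ X : Finset E,
      (∀ a, IsRounding s (Finset.univ.filter (f · = a)).card (X.filter (f · = a)).card) ∧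
      (∀ c, IsRounding s (Finset.univ.filter (g · = c)).card (X.filter (g · = c)).card) ∧
      (∀ k, IsRounding s (Finset.univ.filter (fun e => h (g e) = k)).card
        (X.filter (fun e => h (g e) = k)).card) := by
  classical
  have hs' : (0 : ℚ) < s := by exact_mod_cast hs
  -- The network has levels `A → C → K → hub → A`. Elements are the edges from `A` to `C`, and every
  -- fibre to be controlled has an edge of its own that carries the whole flow of that fibre. The
  -- flow to be rounded is `fib / s`.
  let src : E ⊕ C ⊕ K ⊕ A → A ⊕ C ⊕ K ⊕ Unit :=
    Sum.elim (fun e => .inl (f e)) (Sum.elim (fun c => .inr (.inl c))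
      (Sum.elim (fun k => .inr (.inr (.inl k))) (fun _ => .inr (.inr (.inr ())))))
  let tgt : E ⊕ C ⊕ K ⊕ A → A ⊕ C ⊕ K ⊕ Unit :=
    Sum.elim (fun e => .inr (.inl (g e))) (Sum.elim (fun c => .inr (.inr (.inl (h c))))
      (Sum.elim (fun k => .inr (.inr (.inr ()))) (fun a => .inl a)))
  let fib : E ⊕ C ⊕ K ⊕ A → ℕ :=
    Sum.elim (fun e => 1) (Sum.elim (fun c => (Finset.univ.filter (g · = c)).card)
      (Sum.elim (fun k => (Finset.univ.filter (fun e => h (g e) = k)).card)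
      (fun a => (Finset.univ.filter (f · = a)).card)))
  have hgk : ∀ (X : Finset E) k, (∑ c, if h c = k then (X.filter (g · = c)).card else 0)
      = (X.filter (fun e => h (g e) = k)).card := by
    intro X k
    rw [← Finset.sum_filter, Finset.card_eq_sum_card_fiberwise (f := g)
      (t := Finset.univ.filter (h · = k))]
    · refine Finset.sum_congr rfl fun c hc => ?_
      congr 1
      ext e
      simp only [Finset.mem_filter, Finset.mem_univ, true_and] at hc ⊢
      constructor
      · rintro ⟨h1, rfl⟩
        exact ⟨⟨h1, hc⟩, rfl⟩
      · rintro ⟨⟨h1, _⟩, h2⟩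
        exact ⟨h1, h2⟩
    · intro e he
      simpa using (Finset.mem_filter.1 he).2
  have hfibcons : ∀ v, (∑ e, if src e = v then fib e else 0) = ∑ e, if tgt e = v then fib e else 0 := by
    rintro (a | c | k | _)
    · simp [src, tgt, fib, Fintype.sum_sum_type]
    · simp [src, tgt, fib, Fintype.sum_sum_type]
    · simpa [src, tgt, fib, Fintype.sum_sum_type] using (hgk Finset.univ k).symm
    · simp only [src, tgt, fib, Fintype.sum_sum_type]
      simp only [Sum.elim_inl, Sum.elim_inr, reduceCtorEq, Sum.inr.injEq, if_false, if_true,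
        Finset.sum_const_zero, zero_add, add_zero]
      rw [← Finset.card_eq_sum_card_fiberwise (f := f) (by simp),
        ← Finset.card_eq_sum_card_fiberwise (f := fun e => h (g e)) (by simp)]
  obtain ⟨y, hy, hyb⟩ := exists_int_circulation src tgt (fun e => (fib e : ℚ) / s) (by
    intro v
    have := hfibcons v
    rw [← Finset.sum_filter, ← Finset.sum_filter] at this ⊢
    rw [← Finset.sum_div, ← Finset.sum_div]
    congr 1
    exact_mod_cast this)
  have hround : ∀ e (d : ℕ), y e = d → IsRounding s (fib e) d := by
    intro e d hd q
    obtain ⟨h1, h2⟩ := hyb e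
    rw [hd] at h1 h2
    constructor
    · intro hq
      have : (q : ℤ) ≤ ⌊(fib e : ℚ) / s⌋ := by
        rw [Int.le_floor, le_div_iff₀ hs']
        exact_mod_cast hq
      exact_mod_cast this.trans h1
    · intro hq
      have : ⌈(fib e : ℚ) / s⌉ ≤ (q : ℤ) := by
        rw [Int.ceil_le, div_le_iff₀ hs']
        exact_mod_cast hq
      exact_mod_cast h2.trans this
  -- An element carries `1/s`, which lies in `[0, 1]`, so its rounded value is `0` or `1`.
  have h01 : ∀ e : E, y (.inl e) = if y (.inl e) = 1 then 1 else 0 := by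
    intro e
    obtain ⟨h1, h2⟩ := hyb (.inl e)
    have h3 : (0 : ℤ) ≤ ⌊(fib (.inl e) : ℚ) / s⌋ := by positivity
    have h4 : ⌈(fib (.inl e) : ℚ) / s⌉ ≤ 1 := by
      rw [Int.ceil_le, div_le_iff₀ hs']
      simp only [fib, Sum.elim_inl]
      exact_mod_cast (by omega : 1 ≤ 1 * s)
    split_ifs with h
    · exact h
    · omega
  set X : Finset E := Finset.univ.filter fun e => y (.inl e) = 1 with hX
  have hXsum : ∀ (p : E → Prop) [DecidablePred p],
      (∑ e, if p e then y (.inl e) else 0) = (X.filter p).card := by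
    intro p _
    rw [Finset.card_filter, hX, Finset.sum_filter]
    push_cast
    refine Finset.sum_congr rfl fun e _ => ?_
    by_cases h : y (.inl e) = 1
    · simp [h]
    · have := h01 e
      rw [if_neg h] at this
      simp [this]
  have hA : ∀ a, y (.inr (.inr (.inr a))) = (X.filter (f · = a)).card := by
    intro a
    have := hy (.inl a)
    simp [src, tgt, Fintype.sum_sum_type] at this
    rw [← this, ← hXsum]
  have hC : ∀ c, y (.inr (.inl c)) = (X.filter (g · = c)).card := by
    intro c
    have := hy (.inr (.inl c))
    simp [src, tgt, Fintype.sum_sum_type] at this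
    rw [this, ← hXsum]
  have hK : ∀ k, y (.inr (.inr (.inl k))) = (X.filter (fun e => h (g e) = k)).card := by
    intro k
    have := hy (.inr (.inr (.inl k)))
    simp [src, tgt, Fintype.sum_sum_type] at this
    rw [this, ← hgk]
    push_cast
    exact Finset.sum_congr rfl fun c _ => by rw [hC]
  exact ⟨X, fun a => hround _ _ (hA a), fun c => hround _ _ (hC c), fun k => hround _ _ (hK k)⟩

/-! ### Paths as lists, and path systems -/

/-- `a` and `b` are neighbours on the path that visits the entries of a list in turn. -/
def PathAdj {α : Type*} : List α → α → α → Prop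
  | x :: y :: l, a, b => s(a, b) = s(x, y) ∨ PathAdj (y :: l) a b
  | _, _, _ => False

section Path
variable {α : Type*}

theorem pathAdj_cons (w : α) (l : List α) (a b : α) :
    PathAdj (w :: l) a b ↔ PathAdj l a b ∨ ∃ x, l.head? = some x ∧ s(a, b) = s(w, x) := by
  cases l with
  | nil => simp [PathAdj]
  | cons y l => simp [PathAdj, or_comm]

theorem pathAdj_append_cons (l l' : List α) (w a b : α) :
    PathAdj (l ++ w :: l') a b ↔ PathAdj l a b ∨ PathAdj (w :: l') a b ∨
      ∃ x, l.getLast? = some x ∧ s(a, b) = s(w, x) := by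
  induction l with
  | nil => simp [PathAdj]
  | cons y l ih =>
    rw [List.cons_append, pathAdj_cons, ih, pathAdj_cons y l]
    cases l with
    | nil => simp [PathAdj, Sym2.eq_swap (a := y)]
    | cons z l =>
      simp only [List.cons_append, List.head?_cons, List.getLast?_cons_cons]
      exact iff_of_eq (by ac_rfl)

theorem PathAdj.mem {l : List α} {a b : α} (h : PathAdj l a b) : a ∈ l ∧ b ∈ l := by
  induction l with
  | nil => exact h.elim
  | cons y l ih =>
    rw [pathAdj_cons] at h
    rcases h with h | ⟨x, hx, h⟩
    · exact ⟨List.mem_cons_of_mem _ (ih h).1, List.mem_cons_of_mem _ (ih h).2⟩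
    · have := List.mem_of_mem_head? hx
      rcases Sym2.eq_iff.1 h with ⟨rfl, rfl⟩ | ⟨rfl, rfl⟩ <;> simp [this]

theorem pathAdj_reverse (l : List α) (a b : α) : PathAdj l.reverse a b ↔ PathAdj l a b := by
  induction l with
  | nil => rfl
  | cons y l ih =>
    rw [List.reverse_cons, pathAdj_append_cons, ih, pathAdj_cons y l, List.getLast?_reverse]
    simp [PathAdj]

theorem pathAdj_iff_getElem (l : List α) (a b : α) :
    PathAdj l a b ↔ ∃ (k : ℕ) (h : k + 1 < l.length), s(a, b) = s(l[k], l[k + 1]) := by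
  induction l with
  | nil => simp [PathAdj]
  | cons y l ih =>
    rw [pathAdj_cons, ih]
    constructor
    · rintro (⟨k, h, hk⟩ | ⟨x, hx, h⟩)
      · exact ⟨k + 1, by simpa using h, by simpa using hk⟩
      · cases l with
        | nil => simp at hx
        | cons z l =>
          refine ⟨0, by simp, ?_⟩
          simp only [List.head?_cons, Option.some.injEq] at hx
          simpa [hx] using h
    · rintro ⟨k, h, hk⟩
      cases k with
      | zero =>
        cases l with
        | nil => simp at h
        | cons z l => exact Or.inr ⟨z, rfl, by simpa using hk⟩
      | succ k => exact Or.inl ⟨k, by simpa using h, by simpa using hk⟩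

variable [DecidableEq α]

/-- The number of ends of the path `l` at the vertex `a`; a path with a single vertex has both ends
there. -/
def endCount (l : List α) (a : α) : ℕ :=
  (if l.head? = some a then 1 else 0) + if l.getLast? = some a then 1 else 0

theorem endCount_reverse (l : List α) (a : α) : endCount l.reverse a = endCount l a := by
  simp [endCount, add_comm]

theorem mem_of_endCount_pos {l : List α} {a : α} (h : 0 < endCount l a) : a ∈ l := by
  unfold endCount at h
  split_ifs at h with h1 h2 h2
  · exact List.mem_of_mem_head? h1
  · exact List.mem_of_mem_head? h1
  · exact List.mem_of_mem_getLast? h2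
  · omega

/-- Reversing a path changes neither its edges nor its ends, so an end to which a new vertex gets
attached may be taken as the head. -/
theorem exists_oriented {l : List α} {a : α} (h : 0 < endCount l a) :
    ∃ l' : List α, l'.head? = some a ∧ (∀ x, x ∈ l' ↔ x ∈ l) ∧ (l.Nodup → l'.Nodup) ∧
      (∀ x y, PathAdj l' x y ↔ PathAdj l x y) ∧ ∀ x, endCount l' x = endCount l x := by
  by_cases h1 : l.head? = some a
  · exact ⟨l, h1, by simp, id, by simp, by simp⟩
  · refine ⟨l.reverse, ?_, by simp, fun h => List.nodup_reverse.2 h, pathAdj_reverse l,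
      endCount_reverse l⟩
    rw [List.head?_reverse]
    by_contra h2
    simp [endCount, h1, h2] at h

/-- The lists in `L` are vertex-disjoint paths that together cover the vertex set `S`. -/
structure PathSystem (S : Finset α) (L : Finset (List α)) : Prop where
  ne_nil : ∀ l ∈ L, l ≠ []
  nodup : ∀ l ∈ L, l.Nodup
  subset : ∀ l ∈ L, ∀ a ∈ l, a ∈ S
  cover : ∀ a ∈ S, ∃ l ∈ L, a ∈ l
  disjoint : ∀ l ∈ L, ∀ l' ∈ L, ∀ a, a ∈ l → a ∈ l' → l = l'

/-- `a` and `b` are neighbours on one of the paths in `L`. -/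
def SystemAdj (L : Finset (List α)) (a b : α) : Prop := ∃ l ∈ L, PathAdj l a b

/-- The number of ends at `a` of paths in `L`. -/
def systemEnds (L : Finset (List α)) (a : α) : ℕ := ∑ l ∈ L, endCount l a

omit [DecidableEq α] in
theorem SystemAdj.mem {S : Finset α} {L : Finset (List α)} (h : PathSystem S L) {a b : α}
    (hab : SystemAdj L a b) : a ∈ S ∧ b ∈ S := by
  obtain ⟨l, hl, hab⟩ := hab
  exact ⟨h.subset l hl a hab.mem.1, h.subset l hl b hab.mem.2⟩

theorem systemEnds_eq_zero {S : Finset α} {L : Finset (List α)} (h : PathSystem S L) {a : α}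
    (ha : a ∉ S) : systemEnds L a = 0 :=
  Finset.sum_eq_zero fun l hl => by
    by_contra hne
    exact ha (h.subset l hl a (mem_of_endCount_pos (Nat.pos_of_ne_zero hne)))

/-- Common bookkeeping for the ways in which a new vertex enters a path system: the paths in `R` are
merged with `w` into one path `p`. The cases `|R| = 0, 1, 2` are used. -/
theorem PathSystem.replace {S : Finset α} {L : Finset (List α)} (h : PathSystem S L) {w : α}
    (hw : w ∉ S) {R : Finset (List α)} (hR : R ⊆ L) {p : List α} (hp : p.Nodup)
    (hmem : ∀ x, x ∈ p ↔ x = w ∨ ∃ l ∈ R, x ∈ l) :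
    PathSystem (insert w S) (insert p (L \ R)) ∧ (insert p (L \ R)).card + R.card = L.card + 1 ∧
      (∀ a b, SystemAdj (insert p (L \ R)) a b ↔ PathAdj p a b ∨ SystemAdj (L \ R) a b) ∧
      ∀ a, systemEnds (insert p (L \ R)) a + ∑ l ∈ R, endCount l a
        = endCount p a + systemEnds L a := by
  have hwp : w ∈ p := (hmem w).2 (Or.inl rfl)
  have hpL : p ∉ L \ R := fun hp' => hw (h.subset p (Finset.mem_sdiff.1 hp').1 w hwp)
  have hdis : ∀ l ∈ L \ R, ∀ a, a ∈ l → a ∉ p := by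
    intro l hl a ha hap
    rw [Finset.mem_sdiff] at hl
    rcases (hmem a).1 hap with rfl | ⟨l', hl', ha'⟩
    · exact hw (h.subset l hl.1 _ ha)
    · exact hl.2 (h.disjoint l hl.1 l' (hR hl') a ha ha' ▸ hl')
  refine ⟨⟨?_, ?_, ?_, ?_, ?_⟩, ?_, ?_, ?_⟩
  · intro l hl
    rcases Finset.mem_insert.1 hl with rfl | hl
    · exact List.ne_nil_of_mem hwp
    · exact h.ne_nil l (Finset.mem_sdiff.1 hl).1
  · intro l hl
    rcases Finset.mem_insert.1 hl with rfl | hl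
    · exact hp
    · exact h.nodup l (Finset.mem_sdiff.1 hl).1
  · intro l hl a ha
    rcases Finset.mem_insert.1 hl with rfl | hl
    · rcases (hmem a).1 ha with rfl | ⟨l', hl', ha'⟩
      · exact Finset.mem_insert_self _ _
      · exact Finset.mem_insert_of_mem (h.subset l' (hR hl') a ha')
    · exact Finset.mem_insert_of_mem (h.subset l (Finset.mem_sdiff.1 hl).1 a ha)
  · intro a ha
    rcases Finset.mem_insert.1 ha with rfl | ha
    · exact ⟨p, Finset.mem_insert_self _ _, hwp⟩
    · obtain ⟨l, hl, hal⟩ := h.cover a ha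
      by_cases hlR : l ∈ R
      · exact ⟨p, Finset.mem_insert_self _ _, (hmem a).2 (Or.inr ⟨l, hlR, hal⟩)⟩
      · exact ⟨l, Finset.mem_insert_of_mem (Finset.mem_sdiff.2 ⟨hl, hlR⟩), hal⟩
  · intro l hl l' hl' a ha ha'
    rcases Finset.mem_insert.1 hl with rfl | hl₁ <;> rcases Finset.mem_insert.1 hl' with rfl | hl₂
    · rfl
    · exact (hdis l' hl₂ a ha' ha).elim
    · exact (hdis l hl₁ a ha ha').elim
    · exact h.disjoint l (Finset.mem_sdiff.1 hl₁).1 l' (Finset.mem_sdiff.1 hl₂).1 a ha ha'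
  · rw [Finset.card_insert_of_notMem hpL, ← Finset.card_sdiff_add_card_eq_card hR]
    omega
  · intro a b
    simp [SystemAdj]
  · intro a
    rw [systemEnds, Finset.sum_insert hpL, add_assoc, Finset.sum_sdiff hR, systemEnds]

/-- A new vertex `w` is joined to a set `D` of at most two ends of distinct paths. -/
theorem PathSystem.extend {S : Finset α} {L : Finset (List α)} (h : PathSystem S L) {w : α}
    (hw : w ∉ S) {D : Finset α} (hD : ∀ a ∈ D, ∃ l ∈ L, 0 < endCount l a)
    (hsep : ∀ l ∈ L, ∀ a ∈ D, ∀ b ∈ D, a ∈ l → b ∈ l → a = b) (hcard : D.card ≤ 2) :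
    ∃ L' : Finset (List α), PathSystem (insert w S) L' ∧ L'.card + D.card = L.card + 1 ∧
      (∀ a b, SystemAdj L' a b ↔ SystemAdj L a b ∨ ∃ x ∈ D, s(a, b) = s(w, x)) ∧
      (∀ a, a ≠ w → systemEnds L' a + (if a ∈ D then 1 else 0) = systemEnds L a) ∧
      systemEnds L' w + D.card = 2 := by
  have hw0 := systemEnds_eq_zero h hw
  have hadj : ∀ R ⊆ L, ∀ a b, SystemAdj L a b ↔ SystemAdj R a b ∨ SystemAdj (L \ R) a b := by
    intro R hR a b
    constructor
    · rintro ⟨l, hl, hab⟩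
      by_cases hlR : l ∈ R
      · exact Or.inl ⟨l, hlR, hab⟩
      · exact Or.inr ⟨l, Finset.mem_sdiff.2 ⟨hl, hlR⟩, hab⟩
    · rintro (⟨l, hl, hab⟩ | ⟨l, hl, hab⟩)
      · exact ⟨l, hR hl, hab⟩
      · exact ⟨l, (Finset.mem_sdiff.1 hl).1, hab⟩
  have hwe : ∀ l ∈ L, endCount l w = 0 := fun l hl => by
    by_contra hne
    exact hw (h.subset l hl w (mem_of_endCount_pos (Nat.pos_of_ne_zero hne)))
  have hwm : ∀ l ∈ L, w ∉ l := fun l hl hwl => hw (h.subset l hl w hwl)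
  -- The new vertex becomes a path by itself, prolongs a path, or links two paths.
  obtain h0 | h1 | h2 : D.card = 0 ∨ D.card = 1 ∨ D.card = 2 := by omega
  · rw [Finset.card_eq_zero] at h0
    subst h0
    obtain ⟨e1, e2, e3, e4⟩ := h.replace hw (Finset.empty_subset L) (List.nodup_singleton w)
      (by simp)
    refine ⟨_, e1, by simpa using e2, fun a b => ?_, fun a ha => ?_, ?_⟩
    · rw [e3]
      simp [PathAdj]
    · have := e4 a
      simp only [Finset.sum_empty, add_zero] at this
      rw [this]
      simp [endCount, Ne.symm ha]
    · have := e4 w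
      simp only [Finset.sum_empty, add_zero] at this
      rw [this, hw0]
      simp [endCount]
  · obtain ⟨x, rfl⟩ := Finset.card_eq_one.1 h1
    obtain ⟨l, hl, hx⟩ := hD x (by simp)
    obtain ⟨l', hh, hm, hn, ha, he⟩ := exists_oriented hx
    have hne : l' ≠ [] := by
      rintro rfl
      simp at hh
    obtain ⟨e1, e2, e3, e4⟩ := h.replace hw (Finset.singleton_subset_iff.2 hl) (p := w :: l')
      (List.nodup_cons.2 ⟨fun hw' => hwm l hl ((hm w).1 hw'), hn (h.nodup l hl)⟩)
      (by simp [hm])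
    have hcnt : ∀ a, endCount (w :: l') a + (if a = x then 1 else 0)
        = endCount l a + if a = w then 1 else 0 := by
      intro a
      rw [← he a]
      obtain ⟨y, t, rfl⟩ := List.exists_cons_of_ne_nil hne
      simp only [List.head?_cons, Option.some.injEq] at hh
      subst hh
      simp only [endCount, List.head?_cons, Option.some.injEq, List.getLast?_cons_cons,
        eq_comm (a := a)]
      omega
    refine ⟨_, e1, by simpa using e2, fun a b => ?_, fun a haw => ?_, ?_⟩
    · rw [e3, hadj {l} (Finset.singleton_subset_iff.2 hl) a b, pathAdj_cons, ha, hh]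
      simp only [Option.some.injEq, SystemAdj, Finset.mem_singleton, exists_eq_left,
        exists_eq_left']
      exact iff_of_eq (by ac_rfl)
    · have := e4 a
      have h2 := hcnt a
      rw [if_neg haw] at h2
      rw [Finset.sum_singleton] at this
      simp only [Finset.mem_singleton]
      omega
    · have := e4 w
      have h2 := hcnt w
      have hwx : w ≠ x := by
        rintro rfl
        exact hwm l hl (mem_of_endCount_pos hx)
      rw [if_pos rfl, if_neg hwx, hwe l hl] at h2
      rw [Finset.sum_singleton, hwe l hl] at this
      simp only [Finset.card_singleton]
      omega
  · obtain ⟨x, y, hxy, rfl⟩ := Finset.card_eq_two.1 h2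
    obtain ⟨l₁, hl₁, hx⟩ := hD x (by simp)
    obtain ⟨l₂, hl₂, hy⟩ := hD y (by simp)
    -- Linking two ends of the same path would close a cycle too early; `hsep` rules this out.
    have hll : l₁ ≠ l₂ := by
      rintro rfl
      exact hxy (hsep l₁ hl₁ x (by simp) y (by simp) (mem_of_endCount_pos hx)
        (mem_of_endCount_pos hy))
    obtain ⟨p, hhp, hmp, hnp, hap, hep⟩ := exists_oriented hx
    obtain ⟨q, hhq, hmq, hnq, haq, heq⟩ := exists_oriented hy
    have hR : ({l₁, l₂} : Finset (List α)) ⊆ L := by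
      simp [Finset.insert_subset_iff, hl₁, hl₂]
    have hnodup : (p.reverse ++ w :: q).Nodup := by
      rw [List.nodup_append]
      refine ⟨List.nodup_reverse.2 (hnp (h.nodup _ hl₁)), List.nodup_cons.2
        ⟨fun hw' => hwm _ hl₂ ((hmq w).1 hw'), hnq (h.nodup _ hl₂)⟩, ?_⟩
      intro a hal b hbl hab
      subst hab
      rw [List.mem_reverse, hmp] at hal
      rcases List.mem_cons.1 hbl with rfl | hbl
      · exact hwm _ hl₁ hal
      · exact hll (h.disjoint _ hl₁ _ hl₂ a hal ((hmq a).1 hbl))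
    obtain ⟨e1, e2, e3, e4⟩ := h.replace hw hR hnodup (by
      intro z
      simp only [List.mem_append, List.mem_reverse, List.mem_cons, hmp, hmq, Finset.mem_insert,
        Finset.mem_singleton, exists_eq_or_imp, exists_eq_left]
      tauto)
    have hcnt : ∀ a, endCount (p.reverse ++ w :: q) a + (if a = x then 1 else 0)
        + (if a = y then 1 else 0) = endCount l₁ a + endCount l₂ a := by
      intro a
      rw [← hep a, ← heq a]
      obtain ⟨x', t, rfl⟩ := List.exists_cons_of_ne_nil (l := p) (by rintro rfl; simp at hhp)
      obtain ⟨y', u, rfl⟩ := List.exists_cons_of_ne_nil (l := q) (by rintro rfl; simp at hhq)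
      simp only [List.head?_cons, Option.some.injEq] at hhp hhq
      subst hhp hhq
      have hh : ((x' :: t).reverse ++ w :: y' :: u).head? = (x' :: t).getLast? := by
        rw [List.head?_append_of_ne_nil _ (by simp), List.head?_reverse]
      have hl : ((x' :: t).reverse ++ w :: y' :: u).getLast? = (y' :: u).getLast? := by
        rw [List.getLast?_append_of_ne_nil _ (by simp), List.getLast?_cons_cons]
      simp only [endCount, hh, hl, List.head?_cons, Option.some.injEq, eq_comm (a := a)]
      omega
    rw [Finset.card_pair hll] at e2
    rw [Finset.card_pair hxy]
    refine ⟨_, e1, by omega, fun a b => ?_, fun a haw => ?_, ?_⟩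
    · rw [e3, hadj _ hR a b, pathAdj_append_cons, pathAdj_reverse, hap, pathAdj_cons, haq, hhq,
        List.getLast?_reverse, hhp]
      simp only [Option.some.injEq, SystemAdj, Finset.mem_insert, Finset.mem_singleton,
        exists_eq_left', exists_eq_or_imp, exists_eq_left, or_assoc]
      exact iff_of_eq (by ac_rfl)
    · have := e4 a
      have h2 := hcnt a
      rw [Finset.sum_pair hll] at this
      simp only [Finset.mem_insert, Finset.mem_singleton]
      by_cases h3 : a = x
      · have h4 : a ≠ y := fun h => hxy (h3.symm.trans h)
        simp only [h3, hxy, if_true, if_false, true_or] at h2 this ⊢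
        omega
      · simp only [h3, if_false, false_or] at h2 this ⊢
        omega
    · have := e4 w
      have h2 := hcnt w
      rw [Finset.sum_pair hll, hwe _ hl₁, hwe _ hl₂] at this
      rw [hwe _ hl₁, hwe _ hl₂] at h2
      have h5 : endCount (p.reverse ++ w :: q) w = 0 := by omega
      omega

end Path

/-! ### Adding one vertex to a partial decomposition -/

section Extension
variable {α ι : Type*} [DecidableEq α]

/-- `I` is a matching on `A` if `e = 1`, and empty if `e = 0`; the vertices of `A` that have no
neighbour yet although they should have one form the set `Q`. -/
structure PartialMatching (e : ℕ) (A : Finset α) (I : α → α → Prop) (Q : Finset α) : Prop where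
  symm : ∀ a b, I a b → I b a
  irrefl : ∀ a, ¬I a a
  mem : ∀ a b, I a b → a ∈ A ∧ b ∈ A
  subset : Q ⊆ A
  degree : ∀ a ∈ A, {b | I a b}.ncard + (if a ∈ Q then 1 else 0) = e

/-- Either a waiting vertex is matched with `w`, or, when `e = 1` and none is selected, `w` itself
starts to wait. -/
theorem PartialMatching.extend [Finite α] {e : ℕ} {A Q D : Finset α} {I : α → α → Prop}
    (h : PartialMatching e A I Q) (he : e ≤ 1) {w : α} (hw : w ∉ A) (hD : D ⊆ Q)
    (hDe : D.card ≤ e) :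
    PartialMatching e (insert w A) (fun a b => I a b ∨ ∃ x ∈ D, s(a, b) = s(w, x))
      (Q \ D ∪ if D.card < e then {w} else ∅) := by
  have hDA := hD.trans h.subset
  have hwQ : w ∉ Q := fun hwQ => hw (h.subset hwQ)
  refine ⟨?_, ?_, ?_, ?_, ?_⟩
  · rintro a b (hab | ⟨x, hx, hab⟩)
    · exact Or.inl (h.symm a b hab)
    · exact Or.inr ⟨x, hx, Sym2.eq_swap.trans hab⟩
  · rintro a (ha | ⟨x, hx, ha⟩)
    · exact h.irrefl a ha
    · rcases Sym2.eq_iff.1 ha with ⟨rfl, rfl⟩ | ⟨rfl, rfl⟩ <;> exact hw (hDA hx)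
  · rintro a b (hab | ⟨x, hx, hab⟩)
    · exact ⟨Finset.mem_insert_of_mem (h.mem a b hab).1,
        Finset.mem_insert_of_mem (h.mem a b hab).2⟩
    · have := hDA hx
      rcases Sym2.eq_iff.1 hab with ⟨rfl, rfl⟩ | ⟨rfl, rfl⟩ <;> simp [this]
  · intro a ha
    rcases Finset.mem_union.1 ha with ha | ha
    · exact Finset.mem_insert_of_mem (h.subset (Finset.mem_sdiff.1 ha).1)
    · split_ifs at ha <;> simp_all
  · intro a ha
    rcases Finset.mem_insert.1 ha with rfl | ha
    · have h1 : {b | I a b ∨ ∃ x ∈ D, s(a, b) = s(a, x)} = (D : Set α) := by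
        ext b
        simp only [Set.mem_ofPred_eq, Finset.mem_coe]
        constructor
        · rintro (hab | ⟨x, hx, hab⟩)
          · exact (hw (h.mem a b hab).1).elim
          · rcases Sym2.eq_iff.1 hab with ⟨_, rfl⟩ | ⟨rfl, rfl⟩ <;> exact hx
        · exact fun hb => Or.inr ⟨b, hb, rfl⟩
      rw [h1, Set.ncard_coe_finset]
      by_cases h2 : D.card < e
      · simp [h2]
        omega
      · simp [h2, hwQ]
        omega
    · have haw : a ≠ w := fun h => hw (h ▸ ha)
      have hd := h.degree a ha
      by_cases haD : a ∈ D
      · have h0 : {b | I a b} = ∅ := by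
          rw [if_pos (hD haD)] at hd
          exact (Set.ncard_eq_zero (Set.toFinite _)).1 (by omega)
        have h1 : {b | I a b ∨ ∃ x ∈ D, s(a, b) = s(w, x)} = {w} := by
          ext b
          have hb : ¬I a b := fun hb => (Set.eq_empty_iff_forall_notMem.1 h0 b) hb
          simp only [Set.mem_ofPred_eq, hb, false_or, Set.mem_singleton_iff]
          constructor
          · rintro ⟨x, hx, hab⟩
            rcases Sym2.eq_iff.1 hab with ⟨h, _⟩ | ⟨_, h⟩
            · exact (haw h).elim
            · exact h
          · rintro rfl
            exact ⟨a, haD, Sym2.eq_swap⟩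
        rw [h1, Set.ncard_singleton, if_neg]
        · rw [if_pos (hD haD), h0, Set.ncard_empty] at hd
          omega
        · split_ifs <;> simp [haD, haw]
      · have h1 : {b | I a b ∨ ∃ x ∈ D, s(a, b) = s(w, x)} = {b | I a b} := by
          ext b
          simp only [Set.mem_ofPred_eq, or_iff_left_iff_imp]
          rintro ⟨x, hx, hab⟩
          rcases Sym2.eq_iff.1 hab with ⟨h, _⟩ | ⟨rfl, _⟩
          · exact (haw h).elim
          · exact (haD hx).elim
        have h2 : (a ∈ Q \ D ∪ if D.card < e then {w} else ∅) ↔ a ∈ Q := by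
          split_ifs <;> simp [haD, haw]
        rw [h1]
        simpa only [h2] using hd

/-- Only the pairs `{w, a}` are new, and such a pair receives the one colour whose set `D c`
contains `a`. -/
theorem existsUnique_extend {κ : Type*} {N : κ → α → α → Prop} {R : α → α → Prop} {A : Finset α}
    {D : κ → Finset α} {w : α} (hw : w ∉ A) (hN : ∀ c a b, N c a b → a ∈ A ∧ b ∈ A)
    (hD : ∀ a ∈ A, ∃! c, a ∈ D c)
    (hu : ∀ a ∈ A, ∀ b ∈ A, a ≠ b → ¬R a b → ∃! c, N c a b) :
    ∀ a ∈ insert w A, ∀ b ∈ insert w A, a ≠ b → ¬R a b →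
      ∃! c, N c a b ∨ ∃ x ∈ D c, s(a, b) = s(w, x) := by
  intro a ha b hb hab hR
  have hnew : ∀ c, ∀ b ∈ A, (N c w b ∨ ∃ x ∈ D c, s(w, b) = s(w, x)) ↔ b ∈ D c := by
    intro c b hb
    constructor
    · rintro (h | ⟨x, hx, h⟩)
      · exact (hw (hN c w b h).1).elim
      · rcases Sym2.eq_iff.1 h with ⟨_, rfl⟩ | ⟨rfl, rfl⟩ <;> exact hx
    · exact fun h => Or.inr ⟨b, h, rfl⟩
  have hnew' : ∀ c, ∀ a ∈ A, (N c a w ∨ ∃ x ∈ D c, s(a, w) = s(w, x)) ↔ a ∈ D c := by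
    intro c a ha
    constructor
    · rintro (h | ⟨x, hx, h⟩)
      · exact (hw (hN c a w h).2).elim
      · rcases Sym2.eq_iff.1 h with ⟨rfl, rfl⟩ | ⟨rfl, _⟩ <;> exact hx
    · exact fun h => Or.inr ⟨a, h, Sym2.eq_swap⟩
  rcases Finset.mem_insert.1 ha with rfl | haA
  · have hbA := (Finset.mem_insert.1 hb).resolve_left hab.symm
    simpa only [hnew _ b hbA] using hD b hbA
  rcases Finset.mem_insert.1 hb with rfl | hbA
  · simpa only [hnew' _ a haA] using hD a haA
  · have : ∀ c, (N c a b ∨ ∃ x ∈ D c, s(a, b) = s(w, x)) ↔ N c a b := by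
      intro c
      refine or_iff_left_iff_imp.2 ?_
      rintro ⟨x, hx, h⟩
      rcases Sym2.eq_iff.1 h with ⟨rfl, rfl⟩ | ⟨rfl, rfl⟩
      · exact (hw haA).elim
      · exact (hw hbA).elim
    simpa only [this] using hu a haA b hbA hab hR

omit [DecidableEq α] in
theorem not_adj_extend {N : α → α → Prop} {R : α → α → Prop} {A D : Finset α} {w : α}
    (hw : w ∉ A) (hR : ∀ a b, R a b → a ∈ A ∧ b ∈ A) (hRN : ∀ a b, R a b → ¬N a b) :
    ∀ a b, R a b → ¬(N a b ∨ ∃ x ∈ D, s(a, b) = s(w, x)) := by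
  rintro a b hab (h | ⟨x, hx, h⟩)
  · exact hRN a b hab h
  · rcases Sym2.eq_iff.1 h with ⟨rfl, rfl⟩ | ⟨rfl, rfl⟩
    · exact hw (hR _ _ hab).1
    · exact hw (hR _ _ hab).2

/-- The pairs of vertices joined by the colour `i`, or by the matching. -/
def colourAdj (L : ι → Finset (List α)) (I : α → α → Prop) : Option ι → α → α → Prop
  | none => I
  | some i => SystemAdj (L i)

/-- A decomposition of the complete graph on `A`, minus the graph `R`, into path systems and a
partial matching, in which every vertex misses exactly `s` edges.  The colour `i` does not use the
vertices in `Z i`. -/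
structure PartialDecomposition [Fintype ι] (R I₀ : α → α → Prop) (Z : ι → Finset α) (e s : ℕ)
    (A : Finset α) (L : ι → Finset (List α)) (I : α → α → Prop) (Q : Finset α) : Prop where
  path : ∀ i, PathSystem (A \ Z i) (L i)
  card_le : ∀ i, (L i).card ≤ s
  ends : ∀ a ∈ A, ∑ i, systemEnds (L i) a + (if a ∈ Q then 1 else 0) = s
  e_le : e ≤ 1
  matching : PartialMatching e A I Q
  matching_card_le : Q.card ≤ s
  matching_parity : e = 1 → Even (Q.card + s)
  base : ∀ a b, I₀ a b → I a b
  excluded_mem : ∀ a b, R a b → a ∈ A ∧ b ∈ A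
  excluded : ∀ c a b, R a b → ¬colourAdj L I c a b
  existsUnique : ∀ a ∈ A, ∀ b ∈ A, a ≠ b → ¬R a b → ∃! c, colourAdj L I c a b
  Z_subset : ∀ i, Z i ⊆ A
  total : A.card + s = 2 * Fintype.card ι + e + 1

variable [Fintype ι] {R I₀ : α → α → Prop} {Z : ι → Finset α} {e s : ℕ} {A : Finset α}
  {L : ι → Finset (List α)} {I : α → α → Prop} {Q : Finset α}

theorem PartialDecomposition.colourAdj_mem (h : PartialDecomposition R I₀ Z e s A L I Q)
    (c : Option ι) (a b : α) (hab : colourAdj L I c a b) : a ∈ A ∧ b ∈ A := by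
  cases c with
  | none => exact h.matching.mem a b hab
  | some i =>
    have := SystemAdj.mem (h.path i) hab
    exact ⟨(Finset.mem_sdiff.1 this.1).1, (Finset.mem_sdiff.1 this.2).1⟩

/-- A choice, for each vertex, of one of the colours that it still misses. -/
theorem PartialDecomposition.exists_choice [Finite α]
    (h : PartialDecomposition R I₀ Z e s A L I Q)
    (hs : 2 ≤ s) :
    ∃ D : Option ι → Finset α, (∀ c, D c ⊆ A) ∧ (∀ a ∈ A, ∃! c, a ∈ D c) ∧ D none ⊆ Q ∧
      (D none).card ≤ e ∧ (Q.card = s → (D none).card = 1) ∧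
      ∀ i, (∀ a ∈ D (some i), ∃ l ∈ L i, 0 < endCount l a) ∧
        (∀ l ∈ L i, ∀ a ∈ D (some i), ∀ b ∈ D (some i), a ∈ l → b ∈ l → a = b) ∧
        (D (some i)).card ≤ 2 ∧ (L i).card + 2 ≤ s + (D (some i)).card := by
  classical
  have := Fintype.ofFinite α
  -- The elements to select from are the open ends: two for each path, and one for each vertex
  -- waiting for a leave edge. The maps `f`, `g`, `k` send an open end to its vertex, to its path,
  -- and to its colour.
  let f : (Σ i, {l // l ∈ L i} × Bool) ⊕ {a // a ∈ Q} → Option α :=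
    Sum.elim (fun x => if x.2.2 then x.2.1.1.head? else x.2.1.1.getLast?) (fun a => some a)
  let g : (Σ i, {l // l ∈ L i} × Bool) ⊕ {a // a ∈ Q} → (Σ i, {l // l ∈ L i}) ⊕ {a // a ∈ Q} :=
    Sum.elim (fun x => .inl ⟨x.1, x.2.1⟩) .inr
  let k : (Σ i, {l // l ∈ L i}) ⊕ {a // a ∈ Q} → Option ι :=
    Sum.elim (fun x => some x.1) (fun _ => none)
  have hfA : ∀ a, (Finset.univ.filter (f · = some a)).card
      = ∑ i, systemEnds (L i) a + if a ∈ Q then 1 else 0 := by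
    intro a
    rw [Finset.card_filter, Fintype.sum_sum_type, Fintype.sum_sigma]
    congr 1
    · refine Finset.sum_congr rfl fun i _ => ?_
      rw [Fintype.sum_prod_type, systemEnds,
        ← Finset.sum_coe_sort (L i) fun l => endCount l a]
      refine Finset.sum_congr rfl fun l _ => ?_
      rw [Fintype.sum_bool]
      simp [f, endCount]
    · simp only [f, Sum.elim_inr, Option.some.injEq]
      rw [Finset.sum_coe_sort Q (fun b => if b = a then 1 else 0)]
      simp
  have hgC : ∀ x, (Finset.univ.filter (g · = .inl x)).card = 2 := by
    rintro ⟨i, l⟩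
    have : Finset.univ.filter (g · = .inl ⟨i, l⟩)
        = {.inl ⟨i, l, true⟩, .inl ⟨i, l, false⟩} := by
      ext e
      rcases e with ⟨j, l', b⟩ | a
      · by_cases hj : j = i
        · subst hj
          cases b <;> simp [g]
        · simp [g, hj]
      · simp [g]
    rw [this, Finset.card_pair (by simp)]
  have hkN : (Finset.univ.filter (fun x => k (g x) = none)).card = Q.card := by
    rw [Finset.card_filter, Fintype.sum_sum_type]
    simp [g, k]
  have hkS : ∀ i, (Finset.univ.filter (fun x => k (g x) = some i)).card = 2 * (L i).card := by
    intro i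
    rw [Finset.card_filter, Fintype.sum_sum_type, Fintype.sum_sigma,
      Finset.sum_eq_single i (by intro j _ hj; simp [g, k, hj]) (by simp)]
    simp [g, k, mul_comm]
  obtain ⟨X, hXA, hXC, hXK⟩ := exists_equitable_subset f g k s (by omega)
  let D : Option ι → Finset α := fun c => A.filter fun a => ∃ x ∈ X, f x = some a ∧ k (g x) = c
  have hD : ∀ c a, a ∈ D c ↔ a ∈ A ∧ ∃ x ∈ X, f x = some a ∧ k (g x) = c := fun c a => by
    simp [D]
  -- A vertex has exactly `s` open ends, so its share `s / s` needs no rounding.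
  have hX1 : ∀ a ∈ A, (X.filter (f · = some a)).card = 1 := by
    intro a ha
    have h1 := hXA (some a) 1
    rw [hfA, h.ends a ha] at h1
    exact le_antisymm (h1.2 (by omega)) (h1.1 (by omega))
  have hXu : ∀ a ∈ A, ∀ x ∈ X, ∀ y ∈ X, f x = some a → f y = some a → x = y := by
    intro a ha x hx y hy hxa hya
    exact Finset.card_le_one.1 (hX1 a ha).le x (by simp [hx, hxa]) y (by simp [hy, hya])
  have hend : ∀ (i : ι) (l : {l // l ∈ L i}) (b : Bool) (a : α), f (.inl ⟨i, l, b⟩) = some a →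
      0 < endCount l.1 a := by
    intro i l b a hf
    cases b <;> simp [f] at hf <;> simp [endCount, hf]
  have hfmem : ∀ x, ∃ a ∈ A, f x = some a := by
    rintro (⟨i, l, b⟩ | a)
    · have hl := (h.path i).ne_nil l l.2
      obtain ⟨a, ha⟩ : ∃ a, f (.inl ⟨i, l, b⟩) = some a := by
        cases b
        · exact ⟨_, List.getLast?_eq_some_getLast hl⟩
        · exact ⟨_, List.head?_eq_some_head hl⟩
      exact ⟨a, (Finset.mem_sdiff.1 ((h.path i).subset l l.2 a
        (mem_of_endCount_pos (hend i l b a ha)))).1, ha⟩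
    · exact ⟨a, h.matching.subset a.2, rfl⟩
  have hDcard : ∀ c, (D c).card = (X.filter fun x => k (g x) = c).card := by
    intro c
    rw [← Finset.card_map (f := Function.Embedding.some) (s := D c)]
    have : (D c).map Function.Embedding.some = (X.filter fun x => k (g x) = c).image f := by
      ext o
      simp only [Finset.mem_map, hD, Finset.mem_image, Finset.mem_filter,
        Function.Embedding.some_apply]
      constructor
      · rintro ⟨a, ⟨_, x, hx, hxa, hxc⟩, rfl⟩
        exact ⟨x, ⟨hx, hxc⟩, hxa⟩
      · rintro ⟨x, ⟨hx, hxc⟩, rfl⟩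
        obtain ⟨a, ha, hxa⟩ := hfmem x
        exact ⟨a, ⟨ha, x, hx, hxa, hxc⟩, hxa.symm⟩
    -- Since every vertex has only one selected end, counting vertices in `D c` is the same as
    -- counting selected ends of colour `c`.
    rw [this, Finset.card_image_of_injOn]
    intro x hx y hy hxy
    obtain ⟨a, ha, hxa⟩ := hfmem x
    exact hXu a ha x (Finset.mem_filter.1 hx).1 y (Finset.mem_filter.1 hy).1 hxa
      (hxy.symm.trans hxa)
  have hDQ : D none ⊆ Q := by
    intro a ha
    obtain ⟨_, x, _, hxa, hxc⟩ := (hD _ _).1 ha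
    rcases x with x | b
    · simp [g, k] at hxc
    · simp only [f, Sum.elim_inr, Option.some.injEq] at hxa
      exact hxa ▸ b.2
  refine ⟨D, fun c => Finset.filter_subset _ _, ?_, hDQ, ?_, ?_, fun i => ⟨?_, ?_, ?_, ?_⟩⟩
  · intro a ha
    obtain ⟨x, hx⟩ := Finset.card_pos.1 (by rw [hX1 a ha]; exact one_pos)
    rw [Finset.mem_filter] at hx
    refine ⟨k (g x), (hD _ _).2 ⟨ha, x, hx.1, hx.2, rfl⟩, fun c hc => ?_⟩
    obtain ⟨_, y, hy, hya, hyc⟩ := (hD _ _).1 hc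
    rw [← hyc, hXu a ha x hx.1 y hy hx.2 hya]
  · rcases Nat.eq_zero_or_pos e with he | he
    · have : Q = ∅ := by
        by_contra hne
        obtain ⟨a, ha⟩ := Finset.nonempty_iff_ne_empty.2 hne
        have := h.matching.degree a (h.matching.subset ha)
        rw [if_pos ha] at this
        omega
      rw [this, Finset.subset_empty] at hDQ
      simp [hDQ]
    · rw [hDcard]
      refine le_trans ((hXK none 1).2 ?_) he
      rw [hkN]
      simpa using h.matching_card_le
  · intro hq
    rw [hDcard]
    have := hXK none 1
    rw [hkN, hq] at this
    exact le_antisymm (this.2 (by omega)) (this.1 (by omega))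
  · intro a ha
    obtain ⟨_, x, _, hxa, hxc⟩ := (hD _ _).1 ha
    rcases x with ⟨j, l, b⟩ | b
    · simp only [g, k, Sum.elim_inl, Option.some.injEq] at hxc
      subst hxc
      exact ⟨l, l.2, hend _ l b a hxa⟩
    · simp [g, k] at hxc
  · intro l hl a ha b hb hal hbl
    have key : ∀ a, a ∈ l → a ∈ D (some i) → ∃ x ∈ X, f x = some a ∧ g x = .inl ⟨i, l, hl⟩ := by
      intro a hal ha
      obtain ⟨_, x, hx, hxa, hxc⟩ := (hD _ _).1 ha
      rcases x with ⟨j, l', b⟩ | b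
      · simp only [g, k, Sum.elim_inl, Option.some.injEq] at hxc
        subst hxc
        have := (h.path j).disjoint l hl l' l'.2 a hal
          (mem_of_endCount_pos (hend _ l' b a hxa))
        subst this
        exact ⟨_, hx, hxa, rfl⟩
      · simp [g, k] at hxc
    obtain ⟨x, hx, hxa, hxg⟩ := key a hal ha
    obtain ⟨y, hy, hyb, hyg⟩ := key b hbl hb
    -- A path has two ends, and `2 ≤ s`, so at most one of them is selected.
    have h1 := (hXC (.inl ⟨i, l, hl⟩) 1).2 (by rw [hgC]; omega)
    have := Finset.card_le_one.1 h1 x (by simp [hx, hxg]) y (by simp [hy, hyg])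
    subst this
    exact Option.some.inj (hxa.symm.trans hyb)
  · rw [hDcard]
    refine (hXK (some i) 2).2 ?_
    rw [hkS]
    exact Nat.mul_le_mul_left 2 (h.card_le i)
  · rw [hDcard]
    have h0 := h.card_le i
    -- A colour with `s` paths has `2s` ends and yields two. With `s - 1` paths it has `2s - 2 ≥ s`
    -- ends and yields at least one. With fewer paths nothing is needed.
    have h1 := (hXK (some i) 1).1
    have h2 := (hXK (some i) 2).1
    rw [hkS] at h1 h2
    by_cases hp : (L i).card = s
    · have := h2 (by omega)
      omega
    by_cases hp' : (L i).card + 1 = s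
    · have := h1 (by omega)
      omega
    · omega

/-- Joining `w` to the vertices of `D c` in colour `c` turns `|L i|` into `|L i| + 1 - |D i|`, which
the choice keeps at most `s - 1`. Each old vertex loses one open end. -/
theorem PartialDecomposition.extend [Finite α] (h : PartialDecomposition R I₀ Z e s A L I Q)
    (hs : 2 ≤ s) {w : α} (hw : w ∉ A) :
    ∃ L' I' Q', PartialDecomposition R I₀ Z e (s - 1) (insert w A) L' I' Q' := by
  classical
  obtain ⟨D, hDA, hDu, hDQ, hDe, hDs, hDi⟩ := h.exists_choice hs
  have hwS : ∀ i, w ∉ A \ Z i := fun i hi => hw (Finset.mem_sdiff.1 hi).1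
  choose L' hL1 hL2 hL3 hL4 hL5 using fun i => (h.path i).extend (hwS i) (hDi i).1 (hDi i).2.1
    (hDi i).2.2.1
  set I' : α → α → Prop := fun a b => I a b ∨ ∃ x ∈ D none, s(a, b) = s(w, x) with hI'
  have hcol : ∀ c a b, colourAdj L' I' c a b ↔
      colourAdj L I c a b ∨ ∃ x ∈ D c, s(a, b) = s(w, x) := by
    rintro (_ | i) a b
    · rfl
    · exact hL3 i a b
  have hM := h.matching.extend h.e_le hw hDQ hDe
  have hwQ : w ∉ Q := fun hwQ => hw (h.matching.subset hwQ)
  set Q' := Q \ D none ∪ if (D none).card < e then {w} else ∅ with hQ'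
  have hone : ∀ a ∈ A, (∑ i, if a ∈ D (some i) then 1 else 0) + (if a ∈ D none then 1 else 0)
      = 1 := by
    intro a ha
    obtain ⟨c, hc, hcu⟩ := hDu a ha
    have : ∑ c, (if a ∈ D c then 1 else 0) = 1 := by
      rw [Finset.sum_eq_single c (fun d _ hd => if_neg fun had => hd (hcu d had)) (by simp),
        if_pos hc]
    rw [Fintype.sum_option] at this
    omega
  have hcardA : ∑ i, (D (some i)).card + (D none).card = A.card := by
    have h1 : ∀ c, (D c).card = ∑ a ∈ A, if a ∈ D c then 1 else 0 := by
      intro c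
      rw [← Finset.card_filter, Finset.filter_mem_eq_inter, Finset.inter_eq_right.2 (hDA c)]
    simp only [h1]
    rw [Finset.sum_comm, ← Finset.sum_add_distrib, Finset.sum_congr rfl hone]
    simp
  have hQcard : Q'.card + (D none).card = Q.card + (e - (D none).card) := by
    rw [hQ', Finset.card_union_of_disjoint, Finset.card_sdiff_of_subset hDQ]
    · have := Finset.card_le_card hDQ
      have := h.e_le
      split_ifs
      · simp
        omega
      · simp
        omega
    · split_ifs <;> simp [hwQ]
  have hwQ' : (if w ∈ Q' then 1 else 0) + (D none).card = e := by
    have := h.e_le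
    by_cases hlt : (D none).card < e
    · simp [hQ', hlt]
      omega
    · simp [hQ', hlt, hwQ]
      omega
  refine ⟨L', I', Q', ⟨fun i => ?_, fun i => ?_, fun a ha => ?_, h.e_le, hM, ?_, fun he => ?_,
    fun a b hab => Or.inl (h.base a b hab), fun a b hab => ?_, fun c a b hab => ?_, ?_,
    fun i => (h.Z_subset i).trans (Finset.subset_insert _ _), ?_⟩⟩
  · rw [Finset.insert_sdiff_of_notMem _ fun hwZ => hw (h.Z_subset i hwZ)]
    exact hL1 i
  · have h1 := hL2 i
    have h2 := (hDi i).2.2.2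
    omega
  · rcases Finset.mem_insert.1 ha with rfl | ha
    · have h1 : ∑ i, systemEnds (L' i) a + ∑ i, (D (some i)).card = 2 * Fintype.card ι := by
        rw [← Finset.sum_add_distrib, Finset.sum_congr rfl fun i _ => hL5 i]
        simp [mul_comm]
      have := h.total
      omega
    · have haw : a ≠ w := fun h => hw (h ▸ ha)
      have h1 : ∑ i, systemEnds (L' i) a + ∑ i, (if a ∈ D (some i) then 1 else 0)
          = ∑ i, systemEnds (L i) a := by
        rw [← Finset.sum_add_distrib]
        exact Finset.sum_congr rfl fun i _ => hL4 i a haw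
      have h2 : (if a ∈ Q' then 1 else 0) + (if a ∈ D none then 1 else 0)
          = if a ∈ Q then 1 else 0 := by
        have : a ∈ Q' ↔ a ∈ Q ∧ a ∉ D none := by
          rw [hQ']
          split_ifs <;> simp [haw]
        by_cases h3 : a ∈ D none
        · simp [this, h3, hDQ h3]
        · simp [this, h3]
      have h3 := hone a ha
      have h4 := h.ends a ha
      omega
  · have h1 := h.matching_card_le
    have h2 := h.matching_parity
    have h3 := h.e_le
    rcases Nat.eq_zero_or_pos e with he | he
    · have : Q.card ≤ 0 := by
        by_contra hne
        obtain ⟨a, ha⟩ := Finset.card_pos.1 (not_le.1 hne)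
        have := h.matching.degree a (h.matching.subset ha)
        rw [if_pos ha] at this
        omega
      omega
    · have he1 : e = 1 := by omega
      obtain ⟨r, hr⟩ := h2 he1
      by_cases hq : Q.card = s
      · have := hDs hq
        omega
      · omega
  · obtain ⟨r, hr⟩ := h.matching_parity he
    rw [he] at hQcard hDe
    refine ⟨r - (D none).card, ?_⟩
    have := Finset.card_le_card hDQ
    omega
  · exact ⟨Finset.mem_insert_of_mem (h.excluded_mem a b hab).1,
      Finset.mem_insert_of_mem (h.excluded_mem a b hab).2⟩
  · rw [hcol]
    exact not_adj_extend hw h.excluded_mem (h.excluded c) a b hab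
  · simp only [hcol]
    exact existsUnique_extend hw h.colourAdj_mem hDu h.existsUnique
  · rw [Finset.card_insert_of_notMem hw]
    have := h.total
    omega

end Extension

/-! ### Closing paths into cycles -/

section Cycles
variable {α ι : Type*}

/-- `a` and `b` are neighbours on the cycle that visits the entries of a list in turn. -/
def CycleAdj (l : List α) (a b : α) : Prop :=
  PathAdj l a b ∨ ∃ x y, l.head? = some x ∧ l.getLast? = some y ∧ s(a, b) = s(x, y)

/-- Adjacency in `cycleGraph` means a cyclic difference of one: consecutive positions, or the first
and the last. -/
theorem cycleAdj_iff_cycleGraph {l : List α} (hl : 3 ≤ l.length) (a b : α) :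
    CycleAdj l a b ↔
      ∃ u v : Fin l.length, (SimpleGraph.cycleGraph l.length).Adj u v ∧ l[u] = a ∧ l[v] = b := by
  have hadj : ∀ u v : Fin l.length, (SimpleGraph.cycleGraph l.length).Adj u v ↔
      ((u : ℕ) + 1 = v ∨ (v : ℕ) + 1 = u ∨ ((u : ℕ) = 0 ∧ (v : ℕ) + 1 = l.length) ∨
        ((v : ℕ) = 0 ∧ (u : ℕ) + 1 = l.length)) := by
    intro u v
    have hu := u.2
    have hv := v.2
    rw [SimpleGraph.cycleGraph_adj']
    rcases lt_trichotomy u v with huv | rfl | huv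
    · rw [Fin.coe_sub_iff_lt.2 huv, Fin.coe_sub_iff_le.2 huv.le]
      rw [Fin.lt_def] at huv
      omega
    · rw [Fin.coe_sub_iff_le.2 le_rfl]
      omega
    · rw [Fin.coe_sub_iff_lt.2 huv, Fin.coe_sub_iff_le.2 huv.le]
      rw [Fin.lt_def] at huv
      omega
  rw [CycleAdj, pathAdj_iff_getElem, List.head?_eq_getElem?, List.getLast?_eq_getElem?,
    List.getElem?_eq_getElem (by omega), List.getElem?_eq_getElem (by omega)]
  simp only [hadj, Option.some.injEq, exists_eq_left', exists_and_left]
  constructor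
  · rintro (⟨k, hk, h⟩ | h)
    · rcases Sym2.eq_iff.1 h with ⟨rfl, rfl⟩ | ⟨rfl, rfl⟩
      · exact ⟨⟨k, by omega⟩, ⟨k + 1, hk⟩, Or.inl rfl, rfl, rfl⟩
      · exact ⟨⟨k + 1, hk⟩, ⟨k, by omega⟩, Or.inr (Or.inl rfl), rfl, rfl⟩
    · rcases Sym2.eq_iff.1 h with ⟨rfl, rfl⟩ | ⟨rfl, rfl⟩
      · exact ⟨⟨0, by omega⟩, ⟨l.length - 1, by omega⟩,
          Or.inr (Or.inr (Or.inl ⟨rfl, by simp; omega⟩)), rfl, rfl⟩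
      · exact ⟨⟨l.length - 1, by omega⟩, ⟨0, by omega⟩,
          Or.inr (Or.inr (Or.inr ⟨rfl, by simp; omega⟩)), rfl, rfl⟩
  · rintro ⟨⟨u, hu⟩, ⟨v, hv⟩, h | h | ⟨h, h'⟩ | ⟨h, h'⟩, rfl, rfl⟩ <;> simp only at h
    · subst h
      exact Or.inl ⟨u, hv, rfl⟩
    · subst h
      exact Or.inl ⟨v, hu, Sym2.eq_swap⟩
    · subst h
      obtain rfl : v = l.length - 1 := by simp only at h'; omega
      exact Or.inr rfl
    · subst h
      obtain rfl : u = l.length - 1 := by simp only at h'; omega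
      exact Or.inr Sym2.eq_swap

variable [DecidableEq α]

theorem PartialMatching.eq_empty {A Q : Finset α} {I : α → α → Prop}
    (h : PartialMatching 0 A I Q) : Q = ∅ := by
  by_contra hne
  obtain ⟨a, ha⟩ := Finset.nonempty_iff_ne_empty.2 hne
  have := h.degree a (h.subset ha)
  rw [if_pos ha] at this
  omega

/-- Double counting: each path has two ends, also when it is a single vertex. -/
theorem PathSystem.sum_systemEnds {S A : Finset α} {L : Finset (List α)} (h : PathSystem S L)
    (hSA : S ⊆ A) : ∑ a ∈ A, systemEnds L a = 2 * L.card := by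
  simp only [systemEnds]
  rw [Finset.sum_comm, Finset.sum_congr rfl (g := fun _ => 2)]
  · simp [mul_comm]
  intro l hl
  have hne := h.ne_nil l hl
  have h1 : l.head hne ∈ A := hSA (h.subset l hl _ (List.head_mem hne))
  have h2 : l.getLast hne ∈ A := hSA (h.subset l hl _ (List.getLast_mem hne))
  simp [endCount, Finset.sum_add_distrib, List.head?_eq_some_head hne,
    List.getLast?_eq_some_getLast hne, h1, h2]

variable [Fintype α] [Fintype ι]

/-- A decomposition of the complete graph on `α`, minus the graph `R`, into cycles `C i` with
vertex sets `(Z i)ᶜ` and a graph `I ≥ I₀` that is regular of degree `e`. -/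
structure CycleDecomposition (R I₀ : α → α → Prop) (Z : ι → Finset α) (e : ℕ)
    (C : ι → List α) (I : SimpleGraph α) : Prop where
  nodup : ∀ i, (C i).Nodup
  mem_iff : ∀ i a, a ∈ C i ↔ a ∉ Z i
  base : ∀ a b, I₀ a b → I.Adj a b
  degree : ∀ a, (I.neighborSet a).ncard = e
  excluded_leave : ∀ a b, R a b → ¬I.Adj a b
  excluded_cycle : ∀ i a b, R a b → ¬CycleAdj (C i) a b
  existsUnique : ∀ a b, a ≠ b → ¬R a b →
    ∃! c : Option ι, c.elim (I.Adj a b) fun i => CycleAdj (C i) a b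

variable {R I₀ : α → α → Prop} {Z : ι → Finset α} {e s : ℕ} {A : Finset α}
  {L : ι → Finset (List α)} {I : α → α → Prop} {Q : Finset α}

/-- With `s = 1`, counting open ends leaves no slack: every colour is a single path and `|Q| = e`.
The last vertex is joined to both ends of each path and to the vertex in `Q`, if any. -/
theorem PartialDecomposition.close (h : PartialDecomposition R I₀ Z e 1 A L I Q) {w : α}
    (hw : w ∉ A) (hA : insert w A = Finset.univ) : ∃ C I', CycleDecomposition R I₀ Z e C I' := by
  classical
  have hQe : Q.card ≤ e := by
    rcases Nat.eq_zero_or_pos e with rfl | he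
    · simp [h.matching.eq_empty]
    · exact h.matching_card_le.trans he
  have hsum : 2 * ∑ i, (L i).card + Q.card = 2 * Fintype.card ι + e := by
    have h1 := Finset.sum_congr rfl h.ends
    rw [Finset.sum_add_distrib, Finset.sum_comm,
      Finset.sum_congr rfl fun i _ => (h.path i).sum_systemEnds Finset.sdiff_subset,
      ← Finset.mul_sum, Finset.sum_const, smul_eq_mul, mul_one, ← Finset.card_filter,
      Finset.filter_mem_eq_inter, Finset.inter_eq_right.2 h.matching.subset] at h1
    have := h.total
    omega
  have hle : ∑ i, (L i).card ≤ ∑ _i : ι, 1 := Finset.sum_le_sum fun i _ => h.card_le i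
  -- By `hsum` the upper bounds `|L i| ≤ 1` and `|Q| ≤ e` are attained together.
  have hone : ∀ i, (L i).card = 1 := by
    have h1 : ∑ i, (L i).card = ∑ _i : ι, 1 := by
      simp only [Finset.sum_const, Finset.card_univ, smul_eq_mul, mul_one] at hle ⊢
      omega
    exact fun i => (Finset.sum_eq_sum_iff_of_le fun i _ => h.card_le i).1 h1 i (Finset.mem_univ i)
  have hQ : Q.card = e := by
    simp only [Finset.sum_const, Finset.card_univ, smul_eq_mul, mul_one] at hle
    omega
  choose l hl using fun i => Finset.card_eq_one.1 (hone i)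
  have hlL : ∀ i, l i ∈ L i := fun i => by simp [hl]
  have hne : ∀ i, l i ≠ [] := fun i => (h.path i).ne_nil _ (hlL i)
  let D : Option ι → Finset α := fun c => c.elim Q fun i => A.filter fun a => 0 < endCount (l i) a
  have hDu : ∀ a ∈ A, ∃! c, a ∈ D c := by
    intro a ha
    -- Each vertex has exactly one open end left, which determines its colour towards `w`. In
    -- particular no path is a single vertex, since that would give two ends.
    let cnt : Option ι → ℕ := fun c => c.elim (if a ∈ Q then 1 else 0) fun i => endCount (l i) a
    have hcnt : ∑ c, cnt c = 1 := by
      rw [Fintype.sum_option, add_comm, ← h.ends a ha]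
      simp [cnt, hl, systemEnds]
    have hiff : ∀ c, a ∈ D c ↔ cnt c ≠ 0 := by
      rintro (_ | i)
      · simp [D, cnt]
      · simp [D, cnt, ha, Nat.pos_iff_ne_zero]
    obtain ⟨c, -, hc⟩ := Finset.exists_ne_zero_of_sum_ne_zero (hcnt ▸ one_ne_zero)
    refine ⟨c, (hiff c).2 hc, fun d hd => ?_⟩
    by_contra hdc
    have h1 := Finset.sum_le_sum_of_subset (f := cnt) (Finset.subset_univ {d, c})
    rw [Finset.sum_pair hdc, hcnt] at h1
    have := (hiff d).1 hd
    omega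
  have hM := h.matching.extend h.e_le hw (D := Q) subset_rfl hQe
  rw [hA, hQ, if_neg (lt_irrefl e), Finset.sdiff_self, Finset.union_empty] at hM
  have hcyc : ∀ i a b, CycleAdj (w :: l i) a b ↔
      SystemAdj (L i) a b ∨ ∃ x ∈ D (some i), s(a, b) = s(w, x) := by
    intro i a b
    have hsys : SystemAdj (L i) a b ↔ PathAdj (l i) a b := by simp [SystemAdj, hl]
    have hlast : (w :: l i).getLast? = (l i).getLast? := by
      obtain ⟨y, t, hy⟩ := List.exists_cons_of_ne_nil (hne i)
      rw [hy, List.getLast?_cons_cons]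
    have hD : ∀ x, x ∈ D (some i) ↔ (l i).head? = some x ∨ (l i).getLast? = some x := by
      intro x
      have hx : 0 < endCount (l i) x → x ∈ A := fun hx =>
        (Finset.mem_sdiff.1 ((h.path i).subset _ (hlL i) x (mem_of_endCount_pos hx))).1
      have hx' : 0 < endCount (l i) x ↔ (l i).head? = some x ∨ (l i).getLast? = some x := by
        unfold endCount
        split_ifs <;> simp_all
      rw [← hx']
      simpa [D] using hx
    rw [CycleAdj, pathAdj_cons, hsys, hlast]
    simp only [hD, List.head?_cons, Option.some.injEq, or_and_right, exists_or, or_assoc,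
      exists_and_left, exists_eq_left']
  refine ⟨fun i => w :: l i, ⟨_, ⟨fun a b => hM.symm a b⟩, ⟨hM.irrefl⟩⟩, ?_, ?_, ?_, ?_, ?_, ?_, ?_⟩
  · intro i
    refine List.nodup_cons.2 ⟨fun hwl => hw ?_, (h.path i).nodup _ (hlL i)⟩
    exact (Finset.mem_sdiff.1 ((h.path i).subset _ (hlL i) w hwl)).1
  · intro i a
    rw [List.mem_cons]
    constructor
    · rintro (rfl | ha)
      · exact fun haZ => hw (h.Z_subset i haZ)
      · exact (Finset.mem_sdiff.1 ((h.path i).subset _ (hlL i) a ha)).2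
    · intro haZ
      rcases Finset.mem_insert.1 (hA ▸ Finset.mem_univ a) with rfl | ha
      · exact Or.inl rfl
      · obtain ⟨p, hp, hap⟩ := (h.path i).cover a (Finset.mem_sdiff.2 ⟨ha, haZ⟩)
        rw [hl, Finset.mem_singleton] at hp
        exact Or.inr (hp ▸ hap)
  · exact fun a b hab => Or.inl (h.base a b hab)
  · intro a
    have := hM.degree a (Finset.mem_univ a)
    simp only [Finset.notMem_empty, if_false, add_zero] at this
    exact this
  · exact not_adj_extend hw h.excluded_mem (h.excluded none)
  · intro i a b
    simp only [hcyc]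
    exact not_adj_extend hw h.excluded_mem (h.excluded (some i)) a b
  · intro a b hab hR
    have := existsUnique_extend hw h.colourAdj_mem hDu h.existsUnique a (hA ▸ Finset.mem_univ a) b
      (hA ▸ Finset.mem_univ b) hab hR
    refine (existsUnique_congr fun c => ?_).1 this
    cases c with
    | none => rfl
    | some i => exact (hcyc i a b).symm

/-- A partial decomposition extends to a decomposition into cycles. -/
theorem PartialDecomposition.exists_cycleDecomposition
    (h : PartialDecomposition R I₀ Z e s A L I Q) (hs : 1 ≤ s)
    (hA : A.card + s = Fintype.card α) : ∃ C I', CycleDecomposition R I₀ Z e C I' := by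
  induction s, hs using Nat.le_induction generalizing A L I Q with
  | base =>
    have h1 : Aᶜ.card = 1 := by rw [Finset.card_compl]; omega
    obtain ⟨w, hw⟩ := Finset.card_eq_one.1 h1
    have hwA : w ∉ A := by rw [← Finset.mem_compl, hw]; simp
    refine h.close hwA ?_
    rw [Finset.insert_eq, ← hw, Finset.union_comm, Finset.union_compl]
  | succ s hs ih =>
    obtain ⟨w, hw⟩ : ∃ w, w ∉ A := by
      by_contra! hall
      rw [Finset.eq_univ_iff_forall.2 hall, Finset.card_univ] at hA
      omega
    obtain ⟨L', I', Q', h'⟩ := h.extend (by omega) hw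
    refine ih h' ?_
    rw [Finset.card_insert_of_notMem hw]
    omega

end Cycles

/-- Passes from lists to graphs. The embedding `f` allows a cycle that misses some vertices to be
read as a graph on its own vertex set. -/
theorem exists_cycleGraph_iso {α β : Type*} {l : List α} (hl : l.Nodup) {n : ℕ}
    (hn : l.length = n) (hn3 : 3 ≤ n) (f : β ↪ α) (hf : ∀ a, a ∈ l ↔ a ∈ Set.range f) :
    ∃ G : SimpleGraph β, Nonempty (G ≃g SimpleGraph.cycleGraph n) ∧
      ∀ a b, G.Adj a b ↔ CycleAdj l (f a) (f b) := by
  subst hn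
  choose g hg using fun k : Fin l.length => (hf l[k]).1 (List.getElem_mem k.2)
  have hbij : Function.Bijective g := by
    constructor
    · intro u v huv
      have : l[u] = l[v] := by rw [← hg u, ← hg v, huv]
      exact Fin.ext ((List.Nodup.getElem_inj_iff hl).1 this)
    · intro b
      obtain ⟨k, hk, hkb⟩ := List.getElem_of_mem ((hf (f b)).2 ⟨b, rfl⟩)
      exact ⟨⟨k, hk⟩, f.injective ((hg _).trans hkb)⟩
  let e := Equiv.ofBijective g hbij
  refine ⟨(SimpleGraph.cycleGraph l.length).map e,
    ⟨(SimpleGraph.Iso.map e (SimpleGraph.cycleGraph l.length)).symm⟩, fun a b => ?_⟩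
  rw [cycleAdj_iff_cycleGraph hn3, ← e.coe_toEmbedding, SimpleGraph.map_adj]
  refine exists_congr fun u => exists_congr fun v => and_congr_right fun _ => ?_
  rw [← hg u, ← hg v]
  exact and_congr f.injective.eq_iff.symm f.injective.eq_iff.symm

/-! ### Initial configurations on `M` and on the empty set -/

section Construction
variable {α : Type*} [DecidableEq α]

theorem CycleDecomposition.length_add_card [Fintype α] {ι : Type*} {R I₀ : α → α → Prop}
    {Z : ι → Finset α} {e : ℕ} {C : ι → List α} {I : SimpleGraph α}
    (h : CycleDecomposition R I₀ Z e C I) (i : ι) :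
    (C i).length + (Z i).card = Fintype.card α := by
  have : (C i).toFinset = (Z i)ᶜ := by
    ext a
    simp [h.mem_iff]
  rw [← List.toFinset_card_of_nodup (h.nodup i), this, Finset.card_compl_add_card]

theorem pathSystem_singletons (S : Finset α) : PathSystem S (S.image fun a => [a]) := by
  refine ⟨?_, ?_, ?_, ?_, ?_⟩
  · simp
  · simp
  · simp
  · simp
  · simp only [Finset.mem_image]
    rintro _ ⟨x, _, rfl⟩ _ ⟨y, _, rfl⟩ a hx hy
    rw [List.mem_singleton] at hx hy
    rw [← hx, ← hy]

theorem card_singletons (S : Finset α) : (S.image fun a => [a]).card = S.card :=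
  Finset.card_image_of_injective _ fun a b h => by simpa using h

theorem not_systemAdj_singletons (S : Finset α) (a b : α) :
    ¬SystemAdj (S.image fun a => [a]) a b := by
  simp [SystemAdj, PathAdj]

theorem systemEnds_singletons {S : Finset α} {a : α} (ha : a ∈ S) :
    systemEnds (S.image fun a => [a]) a = 2 := by
  rw [systemEnds, Finset.sum_image (fun x _ y _ h => by simpa using h),
    Finset.sum_eq_single a]
  · simp [endCount]
  · intro b _ hb
    simp [endCount, hb]
  · exact fun h => (h ha).elim

open Classical in
/-- A path system whose only edge is the one that gets the colour `i`, if there is one. -/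
theorem exists_pathSystem_edge {κ : Type*} {M : Finset α} {J : SimpleGraph α}
    (hJ : ∀ a b, J.Adj a b → a ∈ M ∧ b ∈ M) {σ : J.edgeSet → κ} (hσ : Function.Injective σ)
    (i : κ) :
    ∃ L, PathSystem M L ∧ L.card ≤ M.card ∧ ((∃ e, σ e = i) → L.card + 1 ≤ M.card) ∧
      (∀ a b, SystemAdj L a b ↔ ∃ e, σ e = i ∧ (e : Sym2 α) = s(a, b)) ∧
      ∀ a ∈ M, systemEnds L a + (if ∃ e, σ e = i ∧ a ∈ (e : Sym2 α) then 1 else 0) = 2 := by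
  by_cases hi : ∃ e, σ e = i
  · obtain ⟨⟨e, he⟩, rfl⟩ := hi
    induction e with | _ x y =>
    have hxy : J.Adj x y := he
    have hM := hJ x y hxy
    have hy : y ∈ M.erase x := Finset.mem_erase.2 ⟨hxy.ne.symm, hM.2⟩
    -- The path on the edge `xy` arises by attaching `x` to `y` in the system of single vertices of
    -- `M` other than `x`.
    obtain ⟨L, h1, h2, h3, h4, h5⟩ := (pathSystem_singletons (M.erase x)).extend
      (Finset.notMem_erase x M) (D := {y})
      (fun a ha => ⟨[a], Finset.mem_image_of_mem _ (Finset.mem_singleton.1 ha ▸ hy),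
        by simp [endCount]⟩)
      (by simp) (by simp)
    rw [Finset.insert_erase hM.1] at h1
    rw [card_singletons, Finset.card_singleton, Finset.card_erase_of_mem hM.1] at h2
    rw [Finset.card_singleton] at h5
    have hpos := Finset.card_pos.2 ⟨x, hM.1⟩
    have hcol : ∀ P : Sym2 α → Prop, (∃ e, σ e = σ ⟨s(x, y), he⟩ ∧ P e) ↔ P s(x, y) := by
      intro P
      constructor
      · rintro ⟨e, h, hP⟩
        rwa [hσ h] at hP
      · exact fun h => ⟨_, rfl, h⟩
    refine ⟨L, h1, by omega, fun _ => by omega, fun a b => ?_, fun a ha => ?_⟩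
    · rw [h3, hcol fun e => e = s(a, b), eq_comm]
      simp [not_systemAdj_singletons]
    · rw [hcol fun e => a ∈ e]
      by_cases hax : a = x
      · subst hax
        rw [if_pos (Sym2.mem_mk_left a y), h5]
      · have := h4 a hax
        rw [systemEnds_singletons (Finset.mem_erase.2 ⟨hax, ha⟩)] at this
        rw [← this]
        simp [hax]
  · have hcol : ∀ P : Sym2 α → Prop, ¬∃ e, σ e = i ∧ P e := by
      rintro P ⟨e, h, -⟩
      exact hi ⟨e, h⟩
    refine ⟨_, pathSystem_singletons M, (card_singletons M).le, fun h => (hi h).elim,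
      fun a b => ?_, fun a ha => ?_⟩
    · exact iff_of_false (not_systemAdj_singletons M a b) (hcol fun e => e = s(a, b))
    · rw [systemEnds_singletons ha, if_neg (hcol fun e => a ∈ e)]

variable [Fintype α]

/-- A decomposition of the complete graph on `M` into a graph `R` and graphs `J₁`, `J₂` of degree
at most `1` extends to a decomposition of the complete graph on `α`. -/
theorem exists_cycleDecomposition_relative {F T : Type*} [Fintype F] [Fintype T] {M : Finset α}
    {R : α → α → Prop} {J₁ J₂ : SimpleGraph α} {e s d₁ d₂ : ℕ}
    (hs : 1 ≤ s) (hMs : M.card + s = Fintype.card α) (he : e ≤ 1) (hd : d₁ ≤ 1)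
    (hde : d₂ ≤ e)
    (hR : ∀ a b, R a b → a ∈ M ∧ b ∈ M)
    (hJ₁ : ∀ a b, J₁.Adj a b → a ∈ M ∧ b ∈ M) (hJ₂ : ∀ a b, J₂.Adj a b → a ∈ M ∧ b ∈ M)
    (hRJ : ∀ a b, R a b → ¬J₁.Adj a b ∧ ¬J₂.Adj a b) (hJJ : Disjoint J₁ J₂)
    (hcov : ∀ a ∈ M, ∀ b ∈ M, a ≠ b → ¬R a b → J₁.Adj a b ∨ J₂.Adj a b)
    (hdeg₁ : ∀ a ∈ M, (J₁.neighborSet a).ncard = d₁)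
    (hdeg₂ : ∀ a ∈ M, (J₂.neighborSet a).ncard = d₂)
    {σ : J₁.edgeSet → F} (hσ : Function.Injective σ)
    (hcap : M.card ≤ s ∨ e = 0 ∧ M.card ≤ s + 1 ∧ Function.Surjective σ)
    (hparity : e = 1 → d₂ < e → Even (M.card + s)) (hparity' : e = 1 → d₂ = 1 → Even s)
    (hends : 2 * Fintype.card F + (e - d₂) = s + d₁)
    (htotal : M.card + s = 2 * (Fintype.card F + Fintype.card T) + e + 1) :
    ∃ C I, CycleDecomposition R J₂.Adj (Sum.elim (fun _ : F => ∅) (fun _ : T => M)) e C I := by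
  classical
  choose L hL1 hL2 hL3 hL4 hL5 using exists_pathSystem_edge hJ₁ hσ
  have hnot : ∀ a b, J₁.Adj a b → ¬J₂.Adj a b := fun a b h1 h2 =>
    (disjoint_iff_inf_le.1 hJJ : J₁ ⊓ J₂ ≤ ⊥) (show (J₁ ⊓ J₂).Adj a b from ⟨h1, h2⟩)
  have hJadj : ∀ i a b, SystemAdj (L i) a b → J₁.Adj a b := by
    intro i a b h
    obtain ⟨⟨e, he⟩, -, rfl⟩ := (hL4 i a b).1 h
    exact he
  have hempty : ∀ a b, ¬SystemAdj (∅ : Finset (List α)) a b := by simp [SystemAdj]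
  let Q : Finset α := if d₂ < e then M else ∅
  have hinit : PartialDecomposition R J₂.Adj (Sum.elim (fun _ : F => ∅) (fun _ : T => M)) e s M
      (Sum.elim L fun _ => ∅) J₂.Adj Q := by
    refine ⟨?_, ?_, fun a ha => ?_, he, ⟨fun a b h => h.symm, fun a => J₂.loopless.irrefl a, hJ₂,
      ?_, fun a ha => ?_⟩, ?_, fun he1 => ?_, fun a b h => h, hR, ?_, ?_, ?_, ?_⟩
    · rintro (i | i)
      · simpa using hL1 i
      · exact ⟨by simp, by simp, by simp, by simp, by simp⟩
    · rintro (i | i)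
      · rcases hcap with h | ⟨-, h, hsurj⟩
        · exact (hL2 i).trans h
        · have := hL3 i (hsurj i)
          simp only [Sum.elim_inl]
          omega
      · simp
    · have h1 : ∑ i, (if ∃ e, σ e = i ∧ a ∈ (e : Sym2 α) then 1 else 0) = d₁ := by
        have hda := hdeg₁ a ha
        obtain rfl | rfl : d₁ = 0 ∨ d₁ = 1 := by omega
        · rw [Set.ncard_eq_zero (Set.toFinite _)] at hda
          refine Finset.sum_eq_zero fun i _ => if_neg ?_
          rintro ⟨⟨e, he⟩, -, hae⟩
          obtain ⟨b, rfl⟩ := hae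
          exact Set.eq_empty_iff_forall_notMem.1 hda b he
        · obtain ⟨b, hb⟩ := Set.ncard_eq_one.1 hda
          have hab : ∀ c, J₁.Adj a c ↔ c = b := fun c => by
            rw [← SimpleGraph.mem_neighborSet, hb, Set.mem_singleton_iff]
          have h : s(a, b) ∈ J₁.edgeSet := (hab b).2 rfl
          rw [Finset.sum_eq_single (σ ⟨s(a, b), h⟩)]
          · exact if_pos ⟨_, rfl, Sym2.mem_mk_left a b⟩
          · rintro i - hi
            refine if_neg ?_
            rintro ⟨⟨e, he⟩, rfl, hae⟩
            obtain ⟨c, rfl⟩ := hae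
            obtain rfl := (hab c).1 he
            exact hi rfl
          · simp
      have h2 : ∑ i, systemEnds (L i) a + d₁ = 2 * Fintype.card F := by
        rw [← h1, ← Finset.sum_add_distrib, Finset.sum_congr rfl (g := fun _ => 2) fun i _ => by convert hL5 i a ha]
        simp [mul_comm]
      have h3 : (if a ∈ Q then 1 else 0) = e - d₂ := by
        simp only [Q]
        by_cases h : d₂ < e
        · simp [h, ha]
          omega
        · simp [h]
          omega
      rw [Fintype.sum_sum_type, h3]
      simp only [Sum.elim_inl, Sum.elim_inr, systemEnds, Finset.sum_empty, Finset.sum_const_zero]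
      simp only [systemEnds] at h2
      omega
    · simp only [Q]
      split_ifs <;> simp
    · have h := hdeg₂ a ha
      change (J₂.neighborSet a).ncard + _ = e
      rw [h]
      simp only [Q]
      by_cases h : d₂ < e
      · simp [h, ha]
        omega
      · simp [h]
        omega
    · simp only [Q]
      split_ifs with h
      · rcases hcap with h' | ⟨h', -⟩
        · exact h'
        · omega
      · simp
    · simp only [Q]
      by_cases h : d₂ < e
      · simpa [h] using hparity he1 h
      · simpa [h] using hparity' he1 (by omega)
    · rintro (_ | i | i) a b hab
      · exact (hRJ a b hab).2
      · intro h
        exact (hRJ a b hab).1 (hJadj i a b h)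
      · exact hempty a b
    · intro a ha b hb hab hRab
      rcases hcov a ha b hb hab hRab with h | h
      · refine ⟨some (.inl (σ ⟨s(a, b), h⟩)), (hL4 _ a b).2 ⟨_, rfl, rfl⟩, ?_⟩
        rintro (_ | i | i) hc
        · exact (hnot a b h hc).elim
        · obtain ⟨⟨e, he⟩, rfl, rfl⟩ := (hL4 i a b).1 hc
          rfl
        · exact (hempty a b hc).elim
      · refine ⟨none, h, ?_⟩
        rintro (_ | i | i) hc
        · rfl
        · exact (hnot a b (hJadj i a b hc) h).elim
        · exact (hempty a b hc).elim
    · rintro (i | i) <;> simp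
    · rw [Fintype.card_sum]
      exact htotal
  exact hinit.exists_cycleDecomposition hs hMs

/-- The complete graph, minus a 1-factor if its order is even, decomposes into Hamiltonian
cycles. -/
theorem exists_hamiltonian_decomposition {m : ℕ} (hm : 3 ≤ m) (hα : Fintype.card α = m) :
    ∃ (J : SimpleGraph α) (t : Fin ((m - 1) / 2) → SimpleGraph α),
      (∀ a, (J.neighborSet a).ncard = (m + 1) % 2) ∧
      (∀ i, Nonempty (t i ≃g SimpleGraph.cycleGraph m)) ∧
      ∀ a b, a ≠ b → ∃! c : Option (Fin ((m - 1) / 2)),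
        c.elim (J.Adj a b) fun i => (t i).Adj a b := by
  -- Starting from `A = ∅` with `s = m` vertices to come, the invariants hold trivially apart from
  -- arithmetic.
  have hinit : PartialDecomposition (fun _ _ : α => False) (fun _ _ => False)
      (fun _ : Fin ((m - 1) / 2) => ∅) ((m + 1) % 2) m ∅ (fun _ => ∅) (fun _ _ => False) ∅ := by
    refine ⟨fun i => ⟨?_, ?_, ?_, ?_, ?_⟩, ?_, ?_, ?_, ⟨?_, ?_, ?_, ?_, ?_⟩, ?_, fun h => ?_, ?_, ?_,
      ?_, ?_, ?_, ?_⟩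
    all_goals try simp
    · omega
    · rw [Nat.even_iff]
      omega
    · omega
  obtain ⟨C, J, h⟩ := hinit.exists_cycleDecomposition (by omega) (by simp [hα])
  choose t ht1 ht2 using fun i => exists_cycleGraph_iso (h.nodup i)
    (by simpa [hα] using h.length_add_card i) hm (Function.Embedding.refl α)
    (by simp [h.mem_iff])
  refine ⟨J, t, h.degree, ht1, fun a b hab => ?_⟩
  simpa only [ht2, Function.Embedding.refl_apply] using h.existsUnique a b hab id

end Construction

/-! ### Minisymposium factorizations -/

namespace Minisymposium

theorem spanningCoe_adj_iff {V : Type*} {M : Set V} (G : SimpleGraph M) (a b : V) :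
    G.spanningCoe.Adj a b ↔ ∃ (ha : a ∈ M) (hb : b ∈ M), G.Adj ⟨a, ha⟩ ⟨b, hb⟩ := by
  rw [SimpleGraph.spanningCoe, SimpleGraph.map_adj]
  constructor
  · rintro ⟨u, v, h, rfl, rfl⟩
    exact ⟨u.2, v.2, h⟩
  · rintro ⟨ha, hb, h⟩
    exact ⟨_, _, h, rfl, rfl⟩

theorem glue_adj_iff {V : Type*} {M : Set V} (T : SimpleGraph M) (U : SimpleGraph (Mᶜ : Set V))
    (a b : V) : (glue T U).Adj a b ↔ T.spanningCoe.Adj a b ∨ U.spanningCoe.Adj a b := Iff.rfl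

theorem isDecomposition_iff {V ι : Type*} (G : SimpleGraph V) (f : ι → SimpleGraph V) :
    IsDecomposition G f ↔
      (∀ a b, G.Adj a b → ∃! i, (f i).Adj a b) ∧ ∀ i a b, (f i).Adj a b → G.Adj a b := by
  constructor
  · rintro ⟨hd, rfl⟩
    refine ⟨fun a b h => ?_, fun i a b h => SimpleGraph.iSup_adj.2 ⟨i, h⟩⟩
    obtain ⟨i, hi⟩ := SimpleGraph.iSup_adj.1 h
    refine ⟨i, hi, fun j hj => ?_⟩
    by_contra hne
    exact (disjoint_iff_inf_le.1 (hd hne) : f j ⊓ f i ≤ ⊥)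
      (show (f j ⊓ f i).Adj a b from ⟨hj, hi⟩)
  · rintro ⟨h1, h2⟩
    refine ⟨fun i j hij => disjoint_iff_inf_le.2 fun a b hab => ?_, ?_⟩
    · exact (hij ((h1 a b (h2 i a b hab.1)).unique hab.1 hab.2)).elim
    · ext a b
      rw [SimpleGraph.iSup_adj]
      exact ⟨fun ⟨i, hi⟩ => h2 i a b hi, fun h => (h1 a b h).exists⟩

theorem isFactor_cycleGraph {n : ℕ} (hn : 3 ≤ n) : IsFactor 2 (SimpleGraph.cycleGraph n) := by
  obtain ⟨k, rfl⟩ := Nat.exists_eq_add_of_le' hn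
  intro x
  rw [Set.ncard_eq_toFinset_card', ← SimpleGraph.cycleGraph_degree_three_le (v := x)]
  rfl

theorem IsFactor.of_iso {V W : Type*} {r : ℕ} {G : SimpleGraph V} {H : SimpleGraph W}
    (hH : IsFactor r H) (φ : G ≃g H) : IsFactor r G := fun x =>
  (Nat.card_congr (φ.mapNeighborSet x)).trans (hH (φ x))

theorem isLeave_iff {V : Type*} [Finite V] (I : SimpleGraph V) :
    IsLeave I ↔ ∀ a, (I.neighborSet a).ncard = (Nat.card V + 1) % 2 := by
  rcases Nat.even_or_odd (Nat.card V) with h | h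
  · have h1 : (Nat.card V + 1) % 2 = 1 := by
      rw [Nat.even_iff] at h
      omega
    simp [IsLeave, h, Nat.not_odd_iff_even.2 h, h1, IsFactor]
  · have h1 : (Nat.card V + 1) % 2 = 0 := by
      rw [Nat.odd_iff] at h
      omega
    rw [h1]
    simp only [IsLeave, h, Nat.not_even_iff_odd.2 h, true_imp_iff, false_imp_iff, and_true]
    constructor
    · rintro rfl a
      rw [Set.ncard_eq_zero (Set.toFinite _)]
      ext b
      simp
    · intro hI
      ext a b
      have := (Set.ncard_eq_zero (Set.toFinite _)).1 (hI a)
      exact iff_of_false (Set.eq_empty_iff_forall_notMem.1 this b) id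

/-- The handshake lemma, needed to compare the number of edges of `J` with the number of Hamiltonian
colours. -/
theorem two_mul_card_edgeSet {α : Type*} [Fintype α] {M : Finset α} {J : SimpleGraph α}
    {d : ℕ} (hJ : ∀ a b, J.Adj a b → a ∈ M)
    (hd : ∀ a ∈ M, (J.neighborSet a).ncard = d) :
    2 * Nat.card J.edgeSet = M.card * d := by
  classical
  have h := J.sum_degrees_eq_twice_card_edges
  have hdeg : ∀ a, J.degree a = (J.neighborSet a).ncard := fun a => by
    rw [Set.ncard_eq_toFinset_card']
    rfl
  rw [Nat.card_eq_fintype_card, ← SimpleGraph.edgeFinset_card, ← h,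
    ← Finset.sum_subset (Finset.subset_univ M), Finset.sum_congr rfl fun a ha =>
      (hdeg a).trans (hd a ha), Finset.sum_const, smul_eq_mul]
  intro a _ ha
  rw [hdeg, Set.ncard_eq_zero (Set.toFinite _)]
  exact Set.eq_empty_iff_forall_notMem.2 fun b hb => ha (hJ a b hb)

theorem ExistsHMSF.of_le {v m : ℕ} (hm : 3 ≤ m) (heven : Even m → 2 * m - 1 ≤ v)
    (hodd : Odd m → 2 * m ≤ v) : ExistsHMSF v m := by
  classical
  have hv : (m % 2 = 0 ∧ 2 * m - 1 ≤ v) ∨ (m % 2 = 1 ∧ 2 * m ≤ v) := by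
    rcases Nat.even_or_odd m with h | h
    · exact Or.inl ⟨Nat.even_iff.1 h, heven h⟩
    · exact Or.inr ⟨Nat.odd_iff.1 h, hodd h⟩
  have hmv : m < v := by omega
  let Mf : Finset (Fin v) := Finset.univ.filter fun x => (x : ℕ) < m
  have hMf : Mf.card = m := by
    have := @Fin.card_filter_val_lt v m
    simp only [Mf]
    omega
  let M : Set (Fin v) := (Mf : Set (Fin v))
  obtain ⟨J, t, hJ, ht, htJ⟩ := exists_hamiltonian_decomposition (α := M) hm
    ((Fintype.card_coe Mf).trans hMf)
  let Js : SimpleGraph (Fin v) := J.spanningCoe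
  let R : Fin v → Fin v → Prop := fun a b => ∃ i, (t i).spanningCoe.Adj a b
  have hRM : ∀ a b, R a b → a ∈ Mf ∧ b ∈ Mf := by
    rintro a b ⟨i, h⟩
    obtain ⟨ha, hb, -⟩ := (spanningCoe_adj_iff _ _ _).1 h
    exact ⟨ha, hb⟩
  have hJM : ∀ a b, Js.Adj a b → a ∈ Mf ∧ b ∈ Mf := by
    intro a b h
    obtain ⟨ha, hb, -⟩ := (spanningCoe_adj_iff _ _ _).1 h
    exact ⟨ha, hb⟩
  have hRJ : ∀ a b, R a b → ¬Js.Adj a b := by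
    rintro a b ⟨i, h⟩ h'
    obtain ⟨ha, hb, h⟩ := (spanningCoe_adj_iff _ _ _).1 h
    obtain ⟨_, _, h'⟩ := (spanningCoe_adj_iff _ _ _).1 h'
    have := (htJ _ _ h'.ne).unique (y₁ := none) (y₂ := some i) h' h
    simp at this
  have hcov : ∀ a ∈ Mf, ∀ b ∈ Mf, a ≠ b → ¬R a b → Js.Adj a b := by
    intro a ha b hb hab hR
    obtain ⟨c, hc, -⟩ := htJ ⟨a, ha⟩ ⟨b, hb⟩ fun h => hab (congrArg Subtype.val h)
    cases c with
    | none => exact (spanningCoe_adj_iff _ _ _).2 ⟨ha, hb, hc⟩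
    | some i => exact (hR ⟨i, (spanningCoe_adj_iff _ _ _).2 ⟨ha, hb, hc⟩⟩).elim
  have hJdeg : ∀ a ∈ Mf, (Js.neighborSet a).ncard = (m + 1) % 2 := by
    intro a ha
    rw [← hJ ⟨a, ha⟩, ← Set.ncard_image_of_injective _ Subtype.val_injective]
    congr 1
    ext b
    constructor
    · intro h
      obtain ⟨_, hb, h⟩ := (spanningCoe_adj_iff _ _ _).1 h
      exact ⟨⟨b, hb⟩, h, rfl⟩
    · rintro ⟨⟨b, hb⟩, h, rfl⟩
      exact (spanningCoe_adj_iff _ _ _).2 ⟨ha, hb, h⟩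
  have hbot : ∀ a : Fin v, ((⊥ : SimpleGraph (Fin v)).neighborSet a).ncard = 0 := by
    intro a
    rw [Set.ncard_eq_zero (Set.toFinite _)]
    ext b
    simp
  -- The prescribed part `I₀` of the leave is `J` if `v` is even. If `v` is odd the leave is empty,
  -- and the edges of `J` have to lie on Hamiltonian cycles.
  obtain ⟨I₀, C, I, hI₀, hC⟩ : ∃ (I₀ : Fin v → Fin v → Prop) (C : Fin ((v - 1) / 2 - (m - 1) / 2) ⊕ Fin ((m - 1) / 2) → _) (I : _),
      (Even v → ∀ a b, Js.Adj a b → I₀ a b) ∧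
      CycleDecomposition R I₀ (Sum.elim (fun _ : Fin ((v - 1) / 2 - (m - 1) / 2) => ∅) (fun _ : Fin ((m - 1) / 2) => Mf))
        ((v + 1) % 2) C I := by
    rcases Nat.even_or_odd v with hve | hvo
    · have hv2 := Nat.even_iff.1 hve
      have hempty : IsEmpty (⊥ : SimpleGraph (Fin v)).edgeSet := by
        rw [SimpleGraph.edgeSet_bot]
        infer_instance
      obtain ⟨C, I, h⟩ := exists_cycleDecomposition_relative (F := Fin ((v - 1) / 2 - (m - 1) / 2)) (T := Fin ((m - 1) / 2)) (M := Mf)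
        (R := R) (J₁ := ⊥) (J₂ := Js) (e := (v + 1) % 2) (s := v - m) (d₁ := 0)
        (d₂ := (m + 1) % 2) (σ := fun e => isEmptyElim e) (by omega)
        (by rw [hMf, Fintype.card_fin]; omega)
        (by omega) (by omega) (by omega) hRM (fun a b h => h.elim) hJM
        (fun a b h => ⟨id, hRJ a b h⟩) disjoint_bot_left
        (fun a ha b hb hab h => Or.inr (hcov a ha b hb hab h)) (fun a _ => hbot a) hJdeg
        (fun e => isEmptyElim e) (Or.inl (by omega))
        (fun _ _ => by rw [Nat.even_iff]; omega) (fun _ _ => by rw [Nat.even_iff]; omega)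
        (by rw [Fintype.card_fin]; omega) (by rw [hMf, Fintype.card_fin, Fintype.card_fin]; omega)
      exact ⟨_, C, I, fun _ a b h => h, h⟩
    · have hv2 := Nat.odd_iff.1 hvo
      have hcard : 2 * Fintype.card Js.edgeSet = m * ((m + 1) % 2) := by
        rw [← Nat.card_eq_fintype_card, ← hMf]
        exact (two_mul_card_edgeSet (fun a b h => (hJM a b h).1) hJdeg).trans (by rw [hMf])
      -- The second alternative occurs only for `m` even and `v = 2m - 1`, where both numbers equal
      -- `m/2`, so an injective colouring of `J` is surjective.
      have hcard' : Fintype.card Js.edgeSet ≤ (v - 1) / 2 - (m - 1) / 2 ∧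
          (m ≤ v - m ∨ m ≤ v - m + 1 ∧ Fintype.card Js.edgeSet = (v - 1) / 2 - (m - 1) / 2) := by
        rcases hv with ⟨h, h'⟩ | ⟨h, h'⟩
        · rw [show (m + 1) % 2 = 1 by omega] at hcard
          omega
        · rw [show (m + 1) % 2 = 0 by omega] at hcard
          omega
      obtain ⟨σ⟩ := Function.Embedding.nonempty_of_card_le (α := Js.edgeSet) (β := Fin ((v - 1) / 2 - (m - 1) / 2))
        (by simpa using hcard'.1)
      obtain ⟨C, I, h⟩ := exists_cycleDecomposition_relative (F := Fin ((v - 1) / 2 - (m - 1) / 2)) (T := Fin ((m - 1) / 2)) (M := Mf)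
        (R := R) (J₁ := Js) (J₂ := ⊥) (e := (v + 1) % 2) (s := v - m) (d₁ := (m + 1) % 2)
        (d₂ := 0) (σ := σ) (by omega) (by rw [hMf, Fintype.card_fin]; omega)
        (by omega) (by omega) (by omega) hRM hJM (fun a b h => h.elim)
        (fun a b h => ⟨hRJ a b h, id⟩) disjoint_bot_right
        (fun a ha b hb hab h => Or.inl (hcov a ha b hb hab h)) hJdeg (fun a _ => hbot a)
        σ.injective
        (by
          rw [hMf]
          refine hcard'.2.imp_right fun h => ⟨by omega, h.1, ?_⟩
          exact ((Fintype.bijective_iff_injective_and_card σ).2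
            ⟨σ.injective, h.2.trans (Fintype.card_fin _).symm⟩).2)
        (fun _ _ => by omega) (fun _ _ => by omega)
        (by rw [Fintype.card_fin]; omega) (by rw [hMf, Fintype.card_fin, Fintype.card_fin]; omega)
      exact ⟨_, C, I, fun h => (Nat.not_even_iff_odd.2 hvo h).elim, h⟩
  choose f hf hfC using fun i : Fin ((v - 1) / 2 - (m - 1) / 2) => exists_cycleGraph_iso (hC.nodup (.inl i))
    (by simpa using hC.length_add_card (.inl i)) (by omega) (Function.Embedding.refl (Fin v))
    (by simp [hC.mem_iff])
  choose u hu huC using fun i : Fin ((m - 1) / 2) => exists_cycleGraph_iso (n := v - m) (hC.nodup (.inr i))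
    (by
      have := hC.length_add_card (.inr i)
      simp only [Sum.elim_inr, hMf, Fintype.card_fin] at this
      omega)
    (by omega) (Function.Embedding.subtype fun a => a ∈ Mᶜ)
    (by intro a; simp [hC.mem_iff, M])
  have huC' : ∀ i a b, (u i).spanningCoe.Adj a b ↔ CycleAdj (C (.inr i)) a b := by
    intro i a b
    rw [spanningCoe_adj_iff]
    constructor
    · rintro ⟨ha, hb, h⟩
      exact (huC i _ _).1 h
    · intro h
      have hmem : ∀ {x y}, CycleAdj (C (.inr i)) x y → x ∈ Mᶜ ∧ y ∈ Mᶜ := by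
        intro x y h
        have : x ∈ C (.inr i) ∧ y ∈ C (.inr i) := by
          rcases h with h | ⟨x', y', hx, hy, h⟩
          · exact h.mem
          · have hx := List.mem_of_mem_head? hx
            have hy := List.mem_of_mem_getLast? hy
            rcases Sym2.eq_iff.1 h with ⟨rfl, rfl⟩ | ⟨rfl, rfl⟩
            · exact ⟨hx, hy⟩
            · exact ⟨hy, hx⟩
        exact ⟨(hC.mem_iff _ _).1 this.1, (hC.mem_iff _ _).1 this.2⟩
      exact ⟨(hmem h).1, (hmem h).2, (huC i ⟨a, _⟩ ⟨b, _⟩).2 h⟩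
  have hfC' : ∀ i a b, (f i).Adj a b ↔ CycleAdj (C (.inl i)) a b := hfC
  refine ⟨hm, hmv, by omega, by omega, fun _ => isFactor_cycleGraph (by omega),
    fun _ => isFactor_cycleGraph hm, fun _ => isFactor_cycleGraph (by omega), M, I, J, f, t, u,
    ?_, ?_, ?_, fun hve a b h => hC.base a b (hI₀ hve a b h), hf, ht, hu, ?_, ?_⟩
  · rw [Set.ncard_coe_finset, hMf]
  · rw [isLeave_iff, Nat.card_eq_fintype_card, Fintype.card_fin]
    exact hC.degree
  · rw [isLeave_iff, Nat.card_eq_fintype_card]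
    intro a
    rw [hJ a]
    congr 2
    exact ((Fintype.card_coe Mf).trans hMf).symm
  · rw [isDecomposition_iff]
    constructor
    · intro a b hab
      rw [SimpleGraph.compl_adj] at hab
      by_cases hR : R a b
      · obtain ⟨i, hi⟩ := hR
        refine ⟨.inr i, (glue_adj_iff _ _ _ _).2 (Or.inl hi), ?_⟩
        rintro (j | j) hj
        · exact (hC.excluded_cycle _ a b ⟨i, hi⟩ ((hfC' j a b).1 hj)).elim
        · rcases (glue_adj_iff _ _ _ _).1 hj with hj | hj
          · obtain ⟨ha, hb, hi⟩ := (spanningCoe_adj_iff _ _ _).1 hi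
            obtain ⟨_, _, hj⟩ := (spanningCoe_adj_iff _ _ _).1 hj
            have := (htJ _ _ hi.ne).unique (y₁ := some j) (y₂ := some i) hj hi
            rw [Option.some.inj this]
          · exact (hC.excluded_cycle _ a b ⟨i, hi⟩ ((huC' j a b).1 hj)).elim
      · obtain ⟨c, hc, hcu⟩ := hC.existsUnique a b hab.1 hR
        have hiff : ∀ i, (Sum.elim f (fun i => glue (t i) (u i)) i).Adj a b ↔
            CycleAdj (C i) a b := by
          rintro (i | i)
          · exact hfC' i a b
          · rw [← huC' i a b]
            -- Outside `R` the cycle on `M` contributes nothing, so only the `U`-part of the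
            -- 2-factor matters.
            exact or_iff_right fun h => hR ⟨i, h⟩
        cases c with
        | none => exact (hab.2 hc).elim
        | some i =>
          exact ⟨i, (hiff i).2 hc, fun j hj => Option.some.inj (hcu (some j) ((hiff j).1 hj))⟩
    · intro i a b hab
      rw [SimpleGraph.compl_adj]
      refine ⟨hab.ne, fun hI => ?_⟩
      have hR : ¬R a b := fun hR => hC.excluded_leave a b hR hI
      have hcyc : CycleAdj (C i) a b := by
        rcases i with i | i
        · exact (hfC' i a b).1 hab
        · exact (huC' i a b).1 (((glue_adj_iff _ _ _ _).1 hab).resolve_left fun h => hR ⟨i, h⟩)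
      have := (hC.existsUnique a b hab.ne hR).unique (y₁ := none) (y₂ := some i) hI hcyc
      simp at this
  · rw [isDecomposition_iff]
    constructor
    · intro a b hab
      rw [SimpleGraph.compl_adj] at hab
      obtain ⟨c, hc, hcu⟩ := htJ a b hab.1
      cases c with
      | none => exact (hab.2 hc).elim
      | some i => exact ⟨i, hc, fun j hj => Option.some.inj (hcu (some j) hj)⟩
    · intro i a b hab
      rw [SimpleGraph.compl_adj]
      refine ⟨hab.ne, fun hJab => ?_⟩
      have := (htJ a b hab.ne).unique (y₁ := none) (y₂ := some i) hJab hab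
      simp at this

/-- The edges from a vertex `y ∉ M` to `M` avoid all glued 2-factors, and `y` has degree two in each
Hamiltonian cycle and degree `(v + 1) % 2` in the leave. -/
theorem ExistsHMSF.le {v m : ℕ} (h : ExistsHMSF v m) :
    m ≤ 2 * ((v - 1) / 2 - (m - 1) / 2) + (v + 1) % 2 := by
  obtain ⟨-, hmv, -, -, hF, -, -, M, I, J, f, t, u, hM, hI, -, -, hf, -, -, hdec, -⟩ := h
  obtain ⟨y, hy⟩ : ∃ y, y ∉ M := by
    by_contra! hall
    rw [Set.eq_univ_iff_forall.2 hall, Set.ncard_univ, Nat.card_eq_fintype_card,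
      Fintype.card_fin] at hM
    omega
  rw [isDecomposition_iff] at hdec
  rw [isLeave_iff, Nat.card_eq_fintype_card, Fintype.card_fin] at hI
  have hsub : M ⊆ (⋃ i, (f i).neighborSet y) ∪ I.neighborSet y := by
    intro x hx
    have hyx : y ≠ x := fun h => hy (h ▸ hx)
    by_cases hIx : I.Adj y x
    · exact Or.inr hIx
    · obtain ⟨i, hi, -⟩ := hdec.1 y x ⟨hyx, hIx⟩
      rcases i with i | i
      · exact Or.inl (Set.mem_iUnion.2 ⟨i, hi⟩)
      · rcases (glue_adj_iff _ _ _ _).1 hi with hi | hi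
        · exact (hy ((spanningCoe_adj_iff _ _ _).1 hi).1).elim
        · obtain ⟨_, hx', _⟩ := (spanningCoe_adj_iff _ _ _).1 hi
          exact (hx' hx).elim
  have h1 := (Set.ncard_le_ncard hsub (Set.toFinite _)).trans (Set.ncard_union_le _ _)
  have h2 : (⋃ i, (f i).neighborSet y).ncard ≤ ∑ i, ((f i).neighborSet y).ncard :=
    Set.ncard_iUnion_le_of_fintype _
  rw [Finset.sum_congr rfl fun i _ => ((hF i).of_iso (hf i).some) y, Finset.sum_const,
    Finset.card_univ, Fintype.card_fin, smul_eq_mul] at h2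
  rw [hM, hI] at h1
  omega

end Minisymposium

theorem mainTheorem1 (v m : ℕ) :
    Minisymposium.ExistsHMSF v m ↔
      3 ≤ m ∧ (Even m → 2 * m - 1 ≤ v) ∧ (Odd m → 2 * m ≤ v) := by
  refine ⟨fun h => ?_, fun h => .of_le h.1 h.2.1 h.2.2⟩
  have hle := h.le
  obtain ⟨hm, hmv, -⟩ := h
  -- For either parity of `v`, the right side of `hle` is `v - m + 1` if `m` is even and `v - m` if
  -- `m` is odd.
  refine ⟨hm, fun he => ?_, fun ho => ?_⟩
  · rw [Nat.even_iff] at he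
    omega
  · rw [Nat.odd_iff] at ho
    omega
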